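/- Let $K=\mathrm{SU}(2)$ and $U=K\times K$, with $K$ embedded diagonally. For $\ell\in\frac12\mathbb N$ (where $0\in\mathbb N$) let $H^\ell=\mathbb C[x,y]_{2\ell}$ be the space of homogeneous polynomials of degree $2\ell$, with the representation $T^\ell(k)p=p\circ k^t$ of $K$ and the Hermitian inner product for which the vectors $\psi^\ell_j=\binom{2\ell}{\ell-j}^{1/2}x^{\ell-j}y^{\ell+j}$, $j=-\ell,-\ell+1,\dots,\ell$, are orthonormal. Let $H^{\ell_1,\ell_2}=H^{\ell_1}\otimes H^{\ell_2}$ and $T^{\ell_1,\ell_2}(k_1,k_2)=T^{\ell_1}(k_1)\otimes T^{\ell_2}(k_2)$. For $\ell,\ell_1,\ell_2\in\frac12\mathbb N$ with $|\ell_1-\ell_2|\le\ell\le\ell_1+\ell_2$ and $\ell_1+\ell_2-\ell\in\mathbb Z$ let $\beta^{\ell_1,\ell_2}_\ell:H^\ell\to H^{\ell_1,\ell_2}$ be the isometric $K$-intertwiner $$\psi^\ell_j\mapsto\sum_{j_1,j_2}C^{\ell_1,\ell_2,\ell}_{j_1,j_2,j}\,\psi^{\ell_1}_{j_1}\otimes\psi^{\ell_2}_{j_2},$$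 where $C^{\ell_1,\ell_2,\ell}_{j_1,j_2,j}$ are the Clebsch--Gordan coefficients in the standard normalization, and let $$\Phi^\ell_{\ell_1,\ell_2}:U\to\mathrm{End}(H^\ell),\qquad \Phi^\ell_{\ell_1,\ell_2}(u)=(\beta^{\ell_1,\ell_2}_\ell)^*\circ T^{\ell_1,\ell_2}(u)\circ\beta^{\ell_1,\ell_2}_\ell$$ be the spherical function of type $\ell$ associated to $(\ell_1,\ell_2)$. Let $\varphi=\Phi^0_{1/2,1/2}:U\to\mathrm{End}(H^0)=\mathbb C$. Then for all such $\ell,\ell_1,\ell_2$ there exist $2\ell+1$ polynomials $q^{\ell,j}_{\ell_1,\ell_2}\in\mathbb C[X]$, $j\in\{-\ell,-\ell+1,\dots,\ell\}$, such that, as functions on $U$, $$\Phi^\ell_{\ell_1,\ell_2}=\sum_{j=-\ell}^{\ell}q^{\ell,j}_{\ell_1,\ell_2}(\varphi)\,\Phi^\ell_{(\ell+j)/2,(\ell-j)/2}.$$ Each $q^{\ell,j}_{\ell_1,\ell_2}$ has degree at most $\ell_1+\ell_2-\ell$, and the degree is equal to $\ell_1+\ell_2-\ell$ if and only if $j=\ell_1-\ell_2$.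 -/

import Mathlib

open scoped TensorProduct

noncomputable section

namespace SU2Spherical

open MvPolynomial

/-!
Half-integers are stored doubled: a natural number `n` stands for the spin `n / 2`, and an
index `a : Fin (n + 1)` stands for the weight `j = a - n / 2`, running through
`-n / 2, -n / 2 + 1, …, n / 2`.
-/

/-- The compact group `K = SU(2)`. The group `U` is `K × K`, and `K` sits in it diagonally. -/
abbrev K : Type := Matrix.specialUnitaryGroup (Fin 2) ℂ

/-- The space `H^ℓ = ℂ[x, y]_{2ℓ}` of homogeneous polynomials of degree `n = 2ℓ`;
`x = X 0` and `y = X 1`. -/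
abbrev H (n : ℕ) : Type := homogeneousSubmodule (Fin 2) ℂ n

/-- `p ∘ kᵗ`, for a homogeneous polynomial `p`: the `i`-th variable is replaced by the
`i`-th coordinate of `kᵗ (x, y)`. -/
def subst (n : ℕ) (k : Matrix (Fin 2) (Fin 2) ℂ) : H n →ₗ[ℂ] H n :=
  (bind₁ k.transpose.toMvPolynomial).toLinearMap.restrict (by
    intro p hp
    have h := IsHomogeneous.aeval (S := ℂ) (φ := p) (m := n) (n := 1) hp
      k.transpose.toMvPolynomial (fun i => Matrix.toMvPolynomial_isHomogeneous _ i)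
    simpa using h)

/-- The representation `T^ℓ` of `K` on `H^ℓ`, `T^ℓ(k) p = p ∘ kᵗ`. -/
def T (n : ℕ) : Representation ℂ K (H n) where
  toFun k := subst n k.1
  map_one' := by
    ext1 p
    apply Subtype.ext
    simp [subst, Matrix.toMvPolynomial_one]
  map_mul' k l := by
    ext1 p
    apply Subtype.ext
    change bind₁ ((k.1 * l.1).transpose.toMvPolynomial) p.1 =
      bind₁ k.1.transpose.toMvPolynomial (bind₁ l.1.transpose.toMvPolynomial p.1)
    rw [bind₁_bind₁, Matrix.transpose_mul]
    congr 2
    funext i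
    exact Matrix.toMvPolynomial_mul _ _ i

/-- The vector `ψ^ℓ_j = binom(2ℓ, ℓ - j)^{1/2} x^{ℓ - j} y^{ℓ + j}`, with `n = 2ℓ`, `a = ℓ + j`. -/
def psi (n : ℕ) (a : Fin (n + 1)) : H n :=
  ⟨C ((Real.sqrt (n.choose (n - a)) : ℝ) : ℂ) * (X 0 ^ (n - a : ℕ) * X 1 ^ (a : ℕ)), by
    have h := (isHomogeneous_C (Fin 2) ((Real.sqrt (n.choose (n - a)) : ℝ) : ℂ)).mul
      ((isHomogeneous_X_pow (R := ℂ) (0 : Fin 2) (n - a : ℕ)).mul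
        (isHomogeneous_X_pow (R := ℂ) (1 : Fin 2) (a : ℕ)))
    have e : 0 + ((n - a : ℕ) + (a : ℕ)) = n := by omega
    rw [e] at h
    exact h⟩

theorem psi_scalar_ne_zero (n : ℕ) (a : Fin (n + 1)) :
    ((Real.sqrt (n.choose (n - a)) : ℝ) : ℂ) ≠ 0 := by
  have h : 0 < n.choose (n - a) := Nat.choose_pos (Nat.sub_le _ _)
  exact_mod_cast (Real.sqrt_pos.mpr (by exact_mod_cast h)).ne'

theorem coeff_psi (n : ℕ) (a b : Fin (n + 1)) :
    coeff (Finsupp.single 0 (n - b : ℕ) + Finsupp.single 1 (b : ℕ)) (psi n a).1 =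
      if a = b then ((Real.sqrt (n.choose (n - a)) : ℝ) : ℂ) else 0 := by
  have e : (psi n a).1 = monomial (Finsupp.single 0 (n - a : ℕ) + Finsupp.single 1 (a : ℕ))
      ((Real.sqrt (n.choose (n - a)) : ℝ) : ℂ) := by
    simp only [psi, X_pow_eq_monomial, monomial_mul, C_mul_monomial, mul_one]
  rw [e, coeff_monomial]
  refine if_congr ⟨fun h => ?_, fun h => by rw [h]⟩ rfl rfl
  have := DFunLike.congr_fun h 1
  simp at this
  exact Fin.ext this

theorem psi_linearIndependent (n : ℕ) : LinearIndependent ℂ (psi n) := by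
  rw [Fintype.linearIndependent_iff]
  intro g hg b
  have h := congrArg (fun p : H n =>
    coeff (Finsupp.single 0 (n - b : ℕ) + Finsupp.single 1 (b : ℕ)) p.1) hg
  simp only [Submodule.coe_sum, Submodule.coe_smul, coeff_sum, coeff_smul, coeff_psi,
    Submodule.coe_zero, coeff_zero, smul_eq_mul, mul_ite, mul_zero] at h
  rw [Finset.sum_ite_eq'] at h
  rw [if_pos (Finset.mem_univ b)] at h
  exact (mul_eq_zero.mp h).resolve_right (psi_scalar_ne_zero n b)

theorem psi_span (n : ℕ) : ⊤ ≤ Submodule.span ℂ (Set.range (psi n)) := by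
  intro p _
  have h : p = ∑ a : Fin (n + 1),
      (coeff (Finsupp.single 0 (n - a : ℕ) + Finsupp.single 1 (a : ℕ)) p.1 *
        (((Real.sqrt (n.choose (n - a)) : ℝ) : ℂ))⁻¹) • psi n a := by
    apply Subtype.ext
    ext m
    by_cases hm : m.degree = n
    · have h2 : m 0 + m 1 = n := by
        rw [← hm, Finsupp.degree_eq_sum, Fin.sum_univ_two]
      obtain ⟨b, hb⟩ : ∃ b : Fin (n + 1),
          m = Finsupp.single 0 (n - b : ℕ) + Finsupp.single 1 (b : ℕ) := by
        refine ⟨⟨m 1, by omega⟩, ?_⟩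
        ext i
        fin_cases i
        · simp; omega
        · simp
      subst hb
      simp only [Submodule.coe_sum, Submodule.coe_smul, coeff_sum, coeff_smul, coeff_psi,
        smul_eq_mul, mul_ite, mul_zero]
      rw [Finset.sum_ite_eq']
      rw [if_pos (Finset.mem_univ b), mul_assoc, inv_mul_cancel₀ (psi_scalar_ne_zero n b), mul_one]
    · have hz : ∀ q : H n, coeff m q.1 = 0 := fun q =>
        (show q.1.IsHomogeneous n from q.2).coeff_eq_zero hm
      rw [hz, hz]
  rw [h]
  exact Submodule.sum_mem _ fun a _ =>
    Submodule.smul_mem _ _ (Submodule.subset_span ⟨a, rfl⟩)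

/-- The standard weight basis of `H^ℓ`. -/
def psiBasis (n : ℕ) : Module.Basis (Fin (n + 1)) ℂ (H n) :=
  Module.Basis.mk (psi_linearIndependent n) (psi_span n)

/-- The Hermitian inner product on `H^ℓ` for which the standard weight basis is orthonormal. -/
@[reducible] def innerCore (n : ℕ) : InnerProductSpace.Core ℂ (H n) where
  inner p q := ∑ a, starRingEnd ℂ ((psiBasis n).repr p a) * (psiBasis n).repr q a
  conj_inner_symm p q := by simp [mul_comm]
  re_inner_nonneg p := by
    rw [map_sum]
    refine Finset.sum_nonneg fun a _ => ?_
    rw [RCLike.conj_mul, ← RCLike.ofReal_pow, RCLike.ofReal_re]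
    positivity
  add_left p q r := by simp [add_mul, Finset.sum_add_distrib]
  smul_left p q c := by simp [Finset.mul_sum, mul_assoc]
  definite p h := by
    have h' : ∑ a, ‖(psiBasis n).repr p a‖ ^ 2 = 0 := by
      have : ((∑ a, ‖(psiBasis n).repr p a‖ ^ 2 : ℝ) : ℂ) = 0 := by
        rw [← h]
        push_cast
        exact Finset.sum_congr rfl fun a _ => (RCLike.conj_mul _).symm
      exact_mod_cast this
    rw [Finset.sum_eq_zero_iff_of_nonneg (fun a _ => by positivity)] at h'
    refine (psiBasis n).ext_elem fun a => ?_
    simpa using h' a (Finset.mem_univ a)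

instance (n : ℕ) : NormedAddCommGroup (H n) := (innerCore n).toNormedAddCommGroup

instance (n : ℕ) : InnerProductSpace ℂ (H n) := .ofCore (innerCore n).toCore

instance (n : ℕ) : FiniteDimensional ℂ (H n) := (psiBasis n).finiteDimensional_of_finite

theorem psiBasis_orthonormal (n : ℕ) : Orthonormal ℂ (psiBasis n) := by
  rw [orthonormal_iff_ite]
  intro a b
  change ∑ c, starRingEnd ℂ ((psiBasis n).repr (psiBasis n a) c) *
    (psiBasis n).repr (psiBasis n b) c = _
  simp [Finsupp.single_apply]

/-- The outer tensor product `T^{ℓ₁,ℓ₂}(k₁, k₂) = T^{ℓ₁}(k₁) ⊗ T^{ℓ₂}(k₂)` of `U = K × K` on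
`H^{ℓ₁,ℓ₂} = H^{ℓ₁} ⊗ H^{ℓ₂}`. -/
def outerT (n₁ n₂ : ℕ) : Representation ℂ (K × K) (H n₁ ⊗[ℂ] H n₂) :=
  Representation.tprod ((T n₁).comp (MonoidHom.fst K K)) ((T n₂).comp (MonoidHom.snd K K))

/-- `1 / z!`, with the usual convention that this is `0` for a negative integer `z`. -/
def invFactorial (z : ℤ) : ℝ := if 0 ≤ z then ((z.toNat.factorial : ℕ) : ℝ)⁻¹ else 0

/-- The Clebsch-Gordan coefficient `C^{ℓ₁,ℓ₂,ℓ}_{j₁,j₂,j}` in the standard normalization, for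
`n₁ = 2ℓ₁`, `n₂ = 2ℓ₂`, `n = 2ℓ`, `a₁ = ℓ₁ + j₁`, `a₂ = ℓ₂ + j₂`, `a = ℓ + j`, where
`|ℓ₁ - ℓ₂| ≤ ℓ ≤ ℓ₁ + ℓ₂` and `ℓ₁ + ℓ₂ - ℓ` is an integer. With
`r = ℓ₁ + ℓ₂ - ℓ`, `s = ℓ₁ + ℓ - ℓ₂`, `t = ℓ₂ + ℓ - ℓ₁` it is zero unless `j₁ + j₂ = j`, and then
`[(2ℓ+1) r! s! t! / (ℓ₁+ℓ₂+ℓ+1)!]^{1/2}`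
`· [(ℓ+j)! (ℓ-j)! (ℓ₁+j₁)! (ℓ₁-j₁)! (ℓ₂+j₂)! (ℓ₂-j₂)!]^{1/2}`
`· ∑_k (-1)^k / [k! (r-k)! (ℓ₁-j₁-k)! (ℓ₂+j₂-k)! (ℓ-ℓ₂+j₁+k)! (ℓ-ℓ₁-j₂+k)!]`. -/
def clebschGordan (n₁ n₂ n : ℕ) (a₁ : Fin (n₁ + 1)) (a₂ : Fin (n₂ + 1)) (a : Fin (n + 1)) : ℝ :=
  let r : ℕ := (n₁ + n₂ - n) / 2
  let s : ℕ := (n₁ + n - n₂) / 2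
  let t : ℕ := (n₂ + n - n₁) / 2
  if (a₁ : ℕ) + a₂ = a + r then
    Real.sqrt (((n + 1) * (r.factorial * s.factorial * t.factorial) : ℝ) /
        ((n₁ + n₂ + n) / 2 + 1 : ℕ).factorial) *
      Real.sqrt (((a : ℕ).factorial : ℝ) * (n - a : ℕ).factorial *
        ((a₁ : ℕ).factorial * (n₁ - a₁ : ℕ).factorial) *
        ((a₂ : ℕ).factorial * (n₂ - a₂ : ℕ).factorial)) *
      ∑ k ∈ Finset.range (r + 1), (-1 : ℝ) ^ k *
        (invFactorial k * invFactorial (r - k) *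
          invFactorial (n₁ - a₁ - k) * invFactorial (a₂ - k) *
          invFactorial (a₁ - r + k) * invFactorial (n₂ - a₂ - r + k))
  else 0

/-- The vector `φ^{ℓ₁,ℓ₂}_{ℓ,j} = ∑_{j₁,j₂} C^{ℓ₁,ℓ₂,ℓ}_{j₁,j₂,j} ψ^{ℓ₁}_{j₁} ⊗ ψ^{ℓ₂}_{j₂}`. -/
def phiVec (n₁ n₂ n : ℕ) (a : Fin (n + 1)) : H n₁ ⊗[ℂ] H n₂ :=
  ∑ a₁, ∑ a₂, (clebschGordan n₁ n₂ n a₁ a₂ a : ℂ) • (psi n₁ a₁ ⊗ₜ[ℂ] psi n₂ a₂)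

/-- The `K`-intertwiner `β : H^ℓ → H^{ℓ₁,ℓ₂}`, `ψ^ℓ_j ↦ φ^{ℓ₁,ℓ₂}_{ℓ,j}`. -/
def beta (n₁ n₂ n : ℕ) : H n →ₗ[ℂ] H n₁ ⊗[ℂ] H n₂ :=
  (psiBasis n).constr ℂ (phiVec n₁ n₂ n)

/-- The spherical function `Φ^ℓ_{ℓ₁,ℓ₂} : U → End(H^ℓ)`, `u ↦ β* ∘ T^{ℓ₁,ℓ₂}(u) ∘ β`, of type
`ℓ = n / 2` associated to `(ℓ₁, ℓ₂) = (n₁ / 2, n₂ / 2)`. -/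
def sphericalFunction (n₁ n₂ n : ℕ) (u : K × K) : Module.End ℂ (H n) :=
  LinearMap.adjoint (beta n₁ n₂ n) ∘ₗ outerT n₁ n₂ u ∘ₗ beta n₁ n₂ n

/-- The zonal spherical function `φ = Φ^0_{1/2,1/2}`. The space `H^0` is one-dimensional, and
the trace is the identification of `End(H^0)` with `ℂ`. -/
def zonal (u : K × K) : ℂ := LinearMap.trace ℂ (H 0) (sphericalFunction 1 1 0 u)

end SU2Spherical

end

noncomputable section

namespace SU2Spherical

open MvPolynomial

/-! The engine is a recurrence in the annihilated degree `r = ℓ₁ + ℓ₂ - ℓ`. Up to the factor 2,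
`φ(k₁, k₂)` is the polarised determinant, bilinear in the entries of `k₁` and `k₂` (`zonal_eq`).
Multiplying a matrix entry by `T^m(k)` decomposes through the neighbouring degrees `m ± 1`
(`entry_smul_T`). Doing this in both factors writes `φ Φ^ℓ_{ℓ₁,ℓ₂}` as a combination of the four
functions `Φ^ℓ_{ℓ₁±1/2,ℓ₂±1/2}` (`product_formula`).

The signs `(+,+)`, `(+,-)`, `(-,+)`, `(-,-)` change `r` by `1, 0, 0, -1`. Since the `(+,+)`
coefficient is nonzero, the recurrence can be solved for it. Induction on `r` then gives the
polynomials, and the top coefficient is inherited from multiplication by `φ` alone, so the index of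
full degree never changes.

The four coefficients come from classical invariant theory: `β*` is a nonzero multiple of the `r`-th
transvectant (`adjoint_beta`), and the four connecting operators are Cayley's Omega, the two
polarisations and multiplication by the determinant `x₁y₂ - y₁x₂`. Omega raises the order of the
transvectant, polarisations commute with Omega, and the determinant commutes with it up to an Euler
operator. -/

/-! ### Derivatives and multiplications on `ℂ[x, y]` -/

/-- The algebra of all polynomials in `x = X 0` and `y = X 1`. -/
abbrev Poly : Type := MvPolynomial (Fin 2) ℂ

/-- The partial derivative, as an endomorphism of the polynomial algebra. -/
def der (i : Fin 2) : Module.End ℂ Poly := (pderiv i).toLinearMap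

/-- Multiplication by a variable, as an endomorphism of the polynomial algebra. -/
def mulVar (i : Fin 2) : Module.End ℂ Poly := LinearMap.mulLeft ℂ (X i)

theorem der_apply (i : Fin 2) (p : Poly) : der i p = pderiv i p := rfl

theorem mulVar_apply (i : Fin 2) (p : Poly) : mulVar i p = X i * p := rfl

theorem der_mul_X (i j : Fin 2) (p : Poly) :
    der i (X j * p) = X j * der i p + if i = j then p else 0 := by
  simp only [der_apply, Derivation.leibniz, pderiv_X, smul_eq_mul, Pi.single_apply, eq_comm]
  split_ifs <;> simp

theorem der_comm (i j : Fin 2) (p : Poly) : der i (der j p) = der j (der i p) := by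
  induction p using MvPolynomial.induction_on with
  | C c => simp [der_apply]
  | add p q hp hq => simp only [map_add, hp, hq]
  | mul_X p k hp =>
    rw [mul_comm, der_mul_X, der_mul_X, map_add, map_add, der_mul_X, der_mul_X, hp]
    split_ifs <;> subst_vars <;> simp only [map_zero, add_zero]

/-! ### Pairings of two pairs of operators -/

section Pairings

variable {A A' B B' : Type*} [AddCommGroup A] [Module ℂ A] [AddCommGroup A'] [Module ℂ A']
  [AddCommGroup B] [Module ℂ B] [AddCommGroup B'] [Module ℂ B']

/-- The antisymmetric pairing `f₀ ⊗ g₁ - f₁ ⊗ g₀` of two pairs of linear maps. -/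
def wedge (f : Fin 2 → A →ₗ[ℂ] A') (g : Fin 2 → B →ₗ[ℂ] B') : A ⊗[ℂ] B →ₗ[ℂ] A' ⊗[ℂ] B' :=
  TensorProduct.map (f 0) (g 1) - TensorProduct.map (f 1) (g 0)

/-- The symmetric pairing `f₀ ⊗ g₀ + f₁ ⊗ g₁` of two pairs of linear maps. -/
def dot (f : Fin 2 → A →ₗ[ℂ] A') (g : Fin 2 → B →ₗ[ℂ] B') : A ⊗[ℂ] B →ₗ[ℂ] A' ⊗[ℂ] B' :=
  TensorProduct.map (f 0) (g 0) + TensorProduct.map (f 1) (g 1)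

theorem wedge_tmul (f : Fin 2 → A →ₗ[ℂ] A') (g : Fin 2 → B →ₗ[ℂ] B') (a : A) (b : B) :
    wedge f g (a ⊗ₜ b) = f 0 a ⊗ₜ g 1 b - f 1 a ⊗ₜ g 0 b := rfl

theorem dot_tmul (f : Fin 2 → A →ₗ[ℂ] A') (g : Fin 2 → B →ₗ[ℂ] B') (a : A) (b : B) :
    dot f g (a ⊗ₜ b) = f 0 a ⊗ₜ g 0 b + f 1 a ⊗ₜ g 1 b := rfl

theorem wedge_zero_left (g : Fin 2 → B →ₗ[ℂ] B') : wedge (0 : Fin 2 → A →ₗ[ℂ] A') g = 0 := by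
  simp [wedge]

theorem wedge_zero_right (f : Fin 2 → A →ₗ[ℂ] A') : wedge f (0 : Fin 2 → B →ₗ[ℂ] B') = 0 := by
  simp [wedge]

theorem wedge_smul_smul (c d : ℂ) (f : Fin 2 → A →ₗ[ℂ] A') (g : Fin 2 → B →ₗ[ℂ] B') :
    wedge (fun i => c • f i) (fun i => d • g i) = (c * d) • wedge f g := by
  simp only [wedge, TensorProduct.map_smul_left, TensorProduct.map_smul_right]
  module

theorem dot_smul_smul (c d : ℂ) (f : Fin 2 → A →ₗ[ℂ] A') (g : Fin 2 → B →ₗ[ℂ] B') :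
    dot (fun i => c • f i) (fun i => d • g i) = (c * d) • dot f g := by
  simp only [dot, TensorProduct.map_smul_left, TensorProduct.map_smul_right]
  module

end Pairings

/-! ### Omega, transvectants and their commutation rules -/

/-- Cayley's Omega operator `∂/∂x₁ ∂/∂y₂ - ∂/∂y₁ ∂/∂x₂`. -/
def omega : Module.End ℂ (Poly ⊗[ℂ] Poly) := wedge der der

/-- The transvectant of order `r`: the `r`-th power of the Omega operator, followed by
restriction to the diagonal. -/
def transvectant (r : ℕ) : Poly ⊗[ℂ] Poly →ₗ[ℂ] Poly := LinearMap.mul' ℂ Poly ∘ₗ omega ^ r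

/-- The commutator of the polarisation `x₂ ∂/∂x₁ + y₂ ∂/∂y₁` with Omega replaces the derivatives in
the second point by those in the first: a determinant with equal rows. -/
theorem omega_dot_der_mulVar : Commute omega (dot der mulVar) := by
  apply TensorProduct.ext'
  intro p q
  simp only [Module.End.mul_apply, omega, wedge_tmul, dot_tmul, map_add, map_sub, mulVar_apply,
    der_mul_X, der_comm 1 0, TensorProduct.tmul_add]
  simp
  abel

theorem omega_dot_mulVar_der : Commute omega (dot mulVar der) := by
  apply TensorProduct.ext'
  intro p q
  simp only [Module.End.mul_apply, omega, wedge_tmul, dot_tmul, map_add, map_sub, mulVar_apply,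
    der_mul_X, der_comm 1 0, TensorProduct.add_tmul]
  simp
  abel

/-- The inclusion of a space of bihomogeneous tensors. -/
def incl (a b : ℕ) : H a ⊗[ℂ] H b →ₗ[ℂ] Poly ⊗[ℂ] Poly :=
  TensorProduct.map (Submodule.subtype _) (Submodule.subtype _)

theorem incl_tmul (a b : ℕ) (p : H a) (q : H b) : incl a b (p ⊗ₜ q) = p.1 ⊗ₜ q.1 := rfl

theorem der_mem (i : Fin 2) {a : ℕ} {p : Poly} (hp : p ∈ homogeneousSubmodule (Fin 2) ℂ a) :
    der i p ∈ homogeneousSubmodule (Fin 2) ℂ (a - 1) :=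
  IsHomogeneous.pderiv (show p.IsHomogeneous a from hp)

theorem der_degree_zero (i : Fin 2) (p : H 0) : der i p.1 = 0 := by
  have h : p.1.IsHomogeneous 0 := p.2
  rw [← totalDegree_zero_iff_isHomogeneous, totalDegree_eq_zero_iff_eq_C] at h
  rw [h, der_apply, pderiv_C]

theorem euler {a : ℕ} (p : H a) : X 0 * der 0 p.1 + X 1 * der 1 p.1 = a • p.1 := by
  have := IsHomogeneous.sum_X_mul_pderiv (show p.1.IsHomogeneous a from p.2)
  rwa [Fin.sum_univ_two] at this

/-- Truncated subtraction is harmless here, since derivatives of constants vanish. -/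
theorem omega_incl (a b : ℕ) (z : H a ⊗[ℂ] H b) :
    ∃ w, omega (incl a b z) = incl (a - 1) (b - 1) w := by
  induction z using TensorProduct.induction_on with
  | zero => exact ⟨0, by simp⟩
  | add z z' h h' =>
    obtain ⟨w, hw⟩ := h
    obtain ⟨w', hw'⟩ := h'
    exact ⟨w + w', by simp only [map_add, hw, hw']⟩
  | tmul p q =>
    exact ⟨(⟨_, der_mem 0 p.2⟩ : H (a - 1)) ⊗ₜ (⟨_, der_mem 1 q.2⟩ : H (b - 1)) -
      (⟨_, der_mem 1 p.2⟩ : H (a - 1)) ⊗ₜ (⟨_, der_mem 0 q.2⟩ : H (b - 1)), rfl⟩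

theorem omega_pow_incl (r a b : ℕ) (z : H a ⊗[ℂ] H b) :
    ∃ w, (omega ^ r) (incl a b z) = incl (a - r) (b - r) w := by
  induction r with
  | zero => exact ⟨z, rfl⟩
  | succ r ih =>
    obtain ⟨w, hw⟩ := ih
    rw [pow_succ', Module.End.mul_apply, hw]
    exact omega_incl _ _ w

theorem omega_incl_eq_zero {a b : ℕ} (h : a = 0 ∨ b = 0) (z : H a ⊗[ℂ] H b) :
    omega (incl a b z) = 0 := by
  induction z using TensorProduct.induction_on with
  | zero => simp
  | add z z' h h' => simp only [map_add, h, h', add_zero]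
  | tmul p q =>
    rw [incl_tmul, omega, wedge_tmul]
    rcases h with rfl | rfl
    · rw [der_degree_zero, der_degree_zero]; simp
    · rw [der_degree_zero, der_degree_zero]; simp

/-- Polarisation passes through `omega ^ r`, and on the diagonal it becomes the Euler operator of
the first factor, whose degree has dropped to `a - r`. -/
theorem transvectant_dot_der_mulVar (r a b : ℕ) (z : H a ⊗[ℂ] H b) :
    transvectant r (dot der mulVar (incl a b z)) =
      ((a - r : ℕ) : ℂ) • transvectant r (incl a b z) := by
  have h : ∀ c d (w : H c ⊗[ℂ] H d), LinearMap.mul' ℂ Poly (dot der mulVar (incl c d w)) =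
      (c : ℂ) • LinearMap.mul' ℂ Poly (incl c d w) := by
    intro c d w
    induction w using TensorProduct.induction_on with
    | zero => simp
    | add z z' h h' => simp only [map_add, h, h', smul_add]
    | tmul p q =>
      rw [incl_tmul, dot_tmul, map_add]
      simp only [LinearMap.mul'_apply, mulVar_apply]
      rw [Nat.cast_smul_eq_nsmul, ← smul_mul_assoc, ← euler]
      ring
  obtain ⟨w, hw⟩ := omega_pow_incl r a b z
  have hc := LinearMap.congr_fun (omega_dot_der_mulVar.pow_left r).eq (incl a b z)
  simp only [Module.End.mul_apply] at hc
  rw [transvectant, LinearMap.comp_apply, LinearMap.comp_apply, hc, hw, h]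

theorem transvectant_dot_mulVar_der (r a b : ℕ) (z : H a ⊗[ℂ] H b) :
    transvectant r (dot mulVar der (incl a b z)) =
      ((b - r : ℕ) : ℂ) • transvectant r (incl a b z) := by
  have h : ∀ c d (w : H c ⊗[ℂ] H d), LinearMap.mul' ℂ Poly (dot mulVar der (incl c d w)) =
      (d : ℂ) • LinearMap.mul' ℂ Poly (incl c d w) := by
    intro c d w
    induction w using TensorProduct.induction_on with
    | zero => simp
    | add z z' h h' => simp only [map_add, h, h', smul_add]
    | tmul p q =>
      rw [incl_tmul, dot_tmul, map_add]
      simp only [LinearMap.mul'_apply, mulVar_apply]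
      rw [Nat.cast_smul_eq_nsmul, ← mul_smul_comm, ← euler]
      ring
  obtain ⟨w, hw⟩ := omega_pow_incl r a b z
  have hc := LinearMap.congr_fun (omega_dot_mulVar_der.pow_left r).eq (incl a b z)
  simp only [Module.End.mul_apply] at hc
  rw [transvectant, LinearMap.comp_apply, LinearMap.comp_apply, hc, hw, h]

theorem transvectant_eq_zero {r a b : ℕ} (h : a < r ∨ b < r) (z : H a ⊗[ℂ] H b) :
    transvectant r (incl a b z) = 0 := by
  obtain ⟨s, t, hr, hs⟩ : ∃ s t, r = t + 1 + s ∧ (a - s = 0 ∨ b - s = 0) := by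
    rcases h with h | h
    · exact ⟨a, r - a - 1, by omega, by omega⟩
    · exact ⟨b, r - b - 1, by omega, by omega⟩
  obtain ⟨w, hw⟩ := omega_pow_incl s a b z
  rw [transvectant, LinearMap.comp_apply, hr, pow_add, Module.End.mul_apply, hw, pow_succ,
    Module.End.mul_apply, omega_incl_eq_zero hs, map_zero, map_zero]

/-- A Capelli-type identity: the commutator of Omega with the determinant is the sum of the two
Euler operators plus 2. -/
theorem omega_wedge_mulVar {a b : ℕ} (z : H a ⊗[ℂ] H b) :
    omega (wedge mulVar mulVar (incl a b z)) =
      wedge mulVar mulVar (omega (incl a b z)) + ((a + b + 2 : ℕ) : ℂ) • incl a b z := by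
  induction z using TensorProduct.induction_on with
  | zero => simp
  | add z z' h h' =>
    simp only [map_add, h, h', smul_add]
    abel
  | tmul p q =>
    have hp : (a : ℂ) • (p.1 ⊗ₜ[ℂ] q.1) =
        (X 0 * der 0 p.1) ⊗ₜ[ℂ] q.1 + (X 1 * der 1 p.1) ⊗ₜ[ℂ] q.1 := by
      rw [TensorProduct.smul_tmul', Nat.cast_smul_eq_nsmul, ← euler, TensorProduct.add_tmul]
    have hq : (b : ℂ) • (p.1 ⊗ₜ[ℂ] q.1) =
        p.1 ⊗ₜ[ℂ] (X 0 * der 0 q.1) + p.1 ⊗ₜ[ℂ] (X 1 * der 1 q.1) := by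
      rw [← TensorProduct.tmul_smul, Nat.cast_smul_eq_nsmul, ← euler, TensorProduct.tmul_add]
    rw [incl_tmul]
    push_cast
    rw [add_smul, add_smul, hp, hq, two_smul]
    simp only [omega, wedge_tmul, map_sub, mulVar_apply, der_mul_X, TensorProduct.tmul_add,
      TensorProduct.add_tmul]
    simp
    abel

theorem transvectant_zero_wedge (z : Poly ⊗[ℂ] Poly) :
    transvectant 0 (wedge mulVar mulVar z) = 0 := by
  induction z using TensorProduct.induction_on with
  | zero => simp
  | add z z' h h' => simp only [map_add, h, h', add_zero]
  | tmul p q =>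
    rw [wedge_tmul, transvectant, pow_zero, LinearMap.comp_apply, Module.End.one_apply, map_sub]
    simp only [LinearMap.mul'_apply, mulVar_apply]
    ring

/-- Each passage of Omega across the determinant contributes a scalar, and the determinant that
survives to the end vanishes on the diagonal. -/
theorem transvectant_succ_wedge (r a b : ℕ) :
    ∃ c : ℂ, ∀ z : H a ⊗[ℂ] H b,
      transvectant (r + 1) (wedge mulVar mulVar (incl a b z)) =
        c • transvectant r (incl a b z) := by
  have h : ∀ (r : ℕ) z, transvectant (r + 1) z = transvectant r (omega z) := by
    intro r z
    rw [transvectant, transvectant, pow_succ]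
    rfl
  induction r generalizing a b with
  | zero =>
    refine ⟨((a + b + 2 : ℕ) : ℂ), fun z => ?_⟩
    rw [h, omega_wedge_mulVar, map_add, transvectant_zero_wedge, zero_add, map_smul]
  | succ r ih =>
    obtain ⟨c, hc⟩ := ih (a - 1) (b - 1)
    refine ⟨c + ((a + b + 2 : ℕ) : ℂ), fun z => ?_⟩
    obtain ⟨w, hw⟩ := omega_incl a b z
    rw [h, omega_wedge_mulVar, map_add, map_smul, hw, hc, ← hw, ← h, add_smul]

/-! ### Raising and lowering operators and their adjoints -/

/-- Multiplication by a variable, as a map `H m → H m'`, for `m' = m + 1`; it is zero for all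
other `m'`. -/
def raise (m m' : ℕ) (i : Fin 2) : H m →ₗ[ℂ] H m' :=
  if h : m' = m + 1 then (mulVar i).restrict (by
    intro p hp
    rw [h, add_comm]
    exact (isHomogeneous_X ℂ i).mul hp) else 0

/-- The partial derivative, as a map `H m → H m'`, for `m = m' + 1`; it is zero for all
other `m'`. -/
def lower (m m' : ℕ) (i : Fin 2) : H m →ₗ[ℂ] H m' :=
  if h : m = m' + 1 then (der i).restrict (by
    intro p hp
    subst h
    exact der_mem i hp) else 0

theorem raise_coe {m m' : ℕ} (h : m' = m + 1) (i : Fin 2) (p : H m) :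
    (raise m m' i p).1 = mulVar i p.1 := by
  rw [raise, dif_pos h]; rfl

theorem lower_coe {m m' : ℕ} (h : m = m' + 1) (i : Fin 2) (p : H m) :
    (lower m m' i p).1 = der i p.1 := by
  rw [lower, dif_pos h]; rfl

theorem raise_of_ne {m m' : ℕ} (h : m' ≠ m + 1) (i : Fin 2) : raise m m' i = 0 := dif_neg h

theorem lower_of_ne {m m' : ℕ} (h : m ≠ m' + 1) (i : Fin 2) : lower m m' i = 0 := dif_neg h

/-- The exponent of `x^(n - a) y^a`. -/
def expo (n a : ℕ) : Fin 2 →₀ ℕ := Finsupp.single 0 (n - a) + Finsupp.single 1 a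

theorem coeff_psiBasis (n : ℕ) (p : H n) (a : Fin (n + 1)) :
    coeff (expo n a) p.1 =
      (psiBasis n).repr p a * ((Real.sqrt (n.choose (n - a)) : ℝ) : ℂ) := by
  conv_lhs => rw [← (psiBasis n).sum_repr p]
  simp only [Submodule.coe_sum, Submodule.coe_smul, coeff_sum, coeff_smul, psiBasis,
    Module.Basis.mk_apply, expo, coeff_psi, smul_eq_mul, mul_ite, mul_zero]
  simp

/-- In monomial coordinates this is the Bombieri product, for which multiplication and
differentiation are adjoint up to a scalar. -/
theorem inner_H (n : ℕ) (p q : H n) : inner ℂ p q =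
    ∑ a : Fin (n + 1), (((a : ℕ).factorial * (n - a : ℕ).factorial / n.factorial : ℝ) : ℂ) *
      (starRingEnd ℂ (coeff (expo n a) p.1) * coeff (expo n a) q.1) := by
  change ∑ a, starRingEnd ℂ ((psiBasis n).repr p a) * (psiBasis n).repr q a = _
  refine Finset.sum_congr rfl fun a _ => ?_
  rw [coeff_psiBasis, coeff_psiBasis]
  have hs : ((Real.sqrt (n.choose (n - a)) : ℝ) : ℂ) * ((Real.sqrt (n.choose (n - a)) : ℝ) : ℂ) =
      ((n.choose (n - a) : ℝ) : ℂ) := by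
    rw [← Complex.ofReal_mul, Real.mul_self_sqrt (by positivity)]
  have hc : (((a : ℕ).factorial * (n - a : ℕ).factorial / n.factorial : ℝ) : ℂ) *
      ((n.choose (n - a) : ℝ) : ℂ) = 1 := by
    have ha : (a : ℕ) ≤ n := by omega
    have := Nat.choose_mul_factorial_mul_factorial (Nat.sub_le n a)
    rw [Nat.sub_sub_self ha] at this
    rw [← Complex.ofReal_mul, ← Complex.ofReal_one, Complex.ofReal_inj, div_mul_eq_mul_div,
      div_eq_one_iff_eq (by positivity)]
    exact_mod_cast (by linarith)
  rw [map_mul, Complex.conj_ofReal]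
  linear_combination (-(starRingEnd ℂ ((psiBasis n).repr p a) * (psiBasis n).repr q a)) * hc -
    (((a : ℕ).factorial * (n - a : ℕ).factorial / n.factorial : ℝ) : ℂ) *
    (starRingEnd ℂ ((psiBasis n).repr p a) * (psiBasis n).repr q a) * hs

theorem expo_zero (n a : ℕ) : expo n a 0 = n - a := by simp [expo]

theorem expo_one (n a : ℕ) : expo n a 1 = a := by simp [expo]

theorem expo_add_zero {m a : ℕ} (h : a ≤ m) :
    expo (m + 1) a = expo m a + Finsupp.single 0 1 := by
  ext i
  fin_cases i
  · simp [expo]; omega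
  · simp [expo]

theorem expo_add_one (m a : ℕ) : expo (m + 1) (a + 1) = expo m a + Finsupp.single 1 1 := by
  ext i
  fin_cases i <;> simp [expo]

theorem inner_lower_left (m : ℕ) (i : Fin 2) (p : H (m + 1)) (q : H m) :
    inner ℂ (lower (m + 1) m i p) q = ((m + 1 : ℕ) : ℂ) * inner ℂ p (raise m (m + 1) i q) := by
  rw [inner_H, inner_H, lower_coe rfl, raise_coe rfl, Finset.mul_sum]
  have hm : (m.factorial : ℂ) ≠ 0 := by exact_mod_cast m.factorial_ne_zero
  have hm' : (m + 1 : ℂ) ≠ 0 := by exact_mod_cast m.succ_ne_zero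
  simp only [der_apply, mulVar_apply, coeff_pderiv]
  fin_cases i
  -- The extra exponent in degree `m + 1` is `y^(m+1)`, which is absent from a multiple of `x`; for
  -- `i = 1` it is `x^(m+1)`.
  · rw [Fin.sum_univ_castSucc (n := m + 1)]
    have h0 : coeff (expo (m + 1) (Fin.last (m + 1) : Fin (m + 2))) (X 0 * q.1) = 0 := by
      rw [coeff_X_mul', if_neg]
      simp [expo]
    simp only [Fin.zero_eta, h0, mul_zero, add_zero]
    refine Finset.sum_congr rfl fun a _ => ?_
    have ha : (a : ℕ) ≤ m := by omega
    rw [Fin.val_castSucc, expo_add_zero ha, expo_zero, add_comm (expo m a), coeff_X_mul,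
      Nat.succ_sub ha, Nat.factorial_succ (m - a), Nat.factorial_succ m, map_mul]
    push_cast
    simp only [map_add, map_one, map_natCast]
    field_simp
  · rw [Fin.sum_univ_succ (n := m + 1)]
    have h0 : coeff (expo (m + 1) ((0 : Fin (m + 2)) : ℕ)) (X 1 * q.1) = 0 := by
      rw [coeff_X_mul', if_neg]
      simp [expo]
    simp only [Fin.mk_one, h0, mul_zero, zero_add]
    refine Finset.sum_congr rfl fun a _ => ?_
    rw [Fin.val_succ, expo_add_one, expo_one, add_comm (expo m a), coeff_X_mul,
      Nat.succ_sub_succ, Nat.factorial_succ a, Nat.factorial_succ m, map_mul]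
    push_cast
    simp only [map_add, map_one, map_natCast]
    field_simp

theorem adjoint_raise (m m' : ℕ) (i : Fin 2) :
    (m' : ℂ) • LinearMap.adjoint (raise m m' i) = lower m' m i := by
  by_cases h : m' = m + 1
  · subst h
    rw [← map_natCast (starRingEnd ℂ), ← map_smulₛₗ, eq_comm, LinearMap.eq_adjoint_iff]
    intro p q
    rw [inner_lower_left, LinearMap.smul_apply, inner_smul_right]
  · rw [raise_of_ne h, lower_of_ne h, map_zero, smul_zero]

theorem adjoint_lower (m m' : ℕ) (i : Fin 2) :
    LinearMap.adjoint (lower m' m i) = (m' : ℂ) • raise m m' i := by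
  rw [← adjoint_raise, map_smulₛₗ, LinearMap.adjoint_adjoint, map_natCast]

/-! ### Equivariance and multiplication by a matrix entry -/

theorem T_coe (m : ℕ) (k : K) (p : H m) : (T m k p).1 = bind₁ k.1.transpose.toMvPolynomial p.1 :=
  rfl

theorem toMvPolynomial_transpose (k : Matrix (Fin 2) (Fin 2) ℂ) (i : Fin 2) :
    k.transpose.toMvPolynomial i = C (k 0 i) * X 0 + C (k 1 i) * X 1 := by
  simp [Matrix.toMvPolynomial, Fin.sum_univ_two, X, C_mul_monomial]

theorem T_comp_raise (m m' : ℕ) (k : K) (i : Fin 2) :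
    T m' k ∘ₗ raise m m' i =
      k.1 0 i • (raise m m' 0 ∘ₗ T m k) + k.1 1 i • (raise m m' 1 ∘ₗ T m k) := by
  by_cases h : m' = m + 1
  · ext1 p
    apply Subtype.ext
    simp only [LinearMap.comp_apply, T_coe, raise_coe h, mulVar_apply, map_mul, bind₁_X_right,
      toMvPolynomial_transpose, LinearMap.add_apply, LinearMap.smul_apply, Submodule.coe_add,
      Submodule.coe_smul, smul_eq_C_mul]
    ring
  · simp [raise_of_ne h]

theorem der_bind₁ (k : Matrix (Fin 2) (Fin 2) ℂ) (i : Fin 2) (p : Poly) :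
    der i (bind₁ k.transpose.toMvPolynomial p) =
      C (k i 0) * bind₁ k.transpose.toMvPolynomial (der 0 p) +
        C (k i 1) * bind₁ k.transpose.toMvPolynomial (der 1 p) := by
  induction p using MvPolynomial.induction_on with
  | C c => simp [der_apply]
  | add p q hp hq =>
    simp only [map_add, hp, hq]
    ring
  | mul_X p j hp =>
    rw [mul_comm, der_mul_X, der_mul_X, map_mul, bind₁_X_right, toMvPolynomial_transpose, add_mul,
      mul_assoc, mul_assoc, map_add, ← smul_eq_C_mul, ← smul_eq_C_mul, map_smul, map_smul,
      der_mul_X, der_mul_X, hp, smul_eq_C_mul, smul_eq_C_mul, map_add, map_add, map_mul, map_mul,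
      bind₁_X_right, toMvPolynomial_transpose]
    fin_cases i <;> fin_cases j <;> simp <;> ring

theorem det_eq_one (k : K) : k.1 0 0 * k.1 1 1 - k.1 0 1 * k.1 1 0 = 1 := by
  rw [← Matrix.det_fin_two]
  exact (Matrix.mem_specialUnitaryGroup_iff.mp k.2).2

/-- The chain rule differentiates after the substitution; solving it for the substituted derivatives
inverts `k`, which uses `det k = 1`. -/
theorem T_comp_lower_zero (m m' : ℕ) (k : K) :
    T m' k ∘ₗ lower m m' 0 =
      k.1 1 1 • (lower m m' 0 ∘ₗ T m k) - k.1 0 1 • (lower m m' 1 ∘ₗ T m k) := by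
  by_cases h : m = m' + 1
  · ext1 p
    apply Subtype.ext
    simp only [LinearMap.comp_apply, T_coe, lower_coe h, LinearMap.sub_apply, LinearMap.smul_apply,
      Submodule.coe_sub, Submodule.coe_smul, der_bind₁, smul_eq_C_mul]
    have := congrArg (C (σ := Fin 2)) (det_eq_one k)
    simp only [map_sub, map_mul, map_one] at this
    linear_combination (-(bind₁ k.1.transpose.toMvPolynomial (der 0 p.1))) * this
  · simp [lower_of_ne h]

theorem T_comp_lower_one (m m' : ℕ) (k : K) :
    T m' k ∘ₗ lower m m' 1 =
      k.1 0 0 • (lower m m' 1 ∘ₗ T m k) - k.1 1 0 • (lower m m' 0 ∘ₗ T m k) := by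
  by_cases h : m = m' + 1
  · ext1 p
    apply Subtype.ext
    simp only [LinearMap.comp_apply, T_coe, lower_coe h, LinearMap.sub_apply, LinearMap.smul_apply,
      Submodule.coe_sub, Submodule.coe_smul, der_bind₁, smul_eq_C_mul]
    have := congrArg (C (σ := Fin 2)) (det_eq_one k)
    simp only [map_sub, map_mul, map_one] at this
    linear_combination (-(bind₁ k.1.transpose.toMvPolynomial (der 1 p.1))) * this
  · simp [lower_of_ne h]

theorem lower_raise (m : ℕ) (i j : Fin 2) (p : H m) :
    (lower (m + 1) m i (raise m (m + 1) j p)).1 =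
      mulVar j (der i p.1) + if i = j then p.1 else 0 := by
  rw [lower_coe rfl, raise_coe rfl, mulVar_apply, der_mul_X, mulVar_apply]

theorem raise_lower (m : ℕ) (i j : Fin 2) (p : H m) :
    (raise (m - 1) m i (lower m (m - 1) j p)).1 = mulVar i (der j p.1) := by
  cases m with
  | zero =>
    rw [raise_of_ne (by omega), der_degree_zero]; simp
  | succ m =>
    change (raise m (m + 1) i (lower (m + 1) m j p)).1 = _
    rw [raise_coe rfl, lower_coe rfl]

/-- The pair `(f₁, -f₀)` of a pair `(f₀, f₁)`. -/
def rot {M : Type*} [AddCommGroup M] (f : Fin 2 → M) : Fin 2 → M := ![f 1, -f 0]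

/-- The product of the matrix entry `k i j` with `T m k`, by the Clebsch-Gordan rule for the tensor
product with the two-dimensional representation. -/
theorem entry_smul_T (m : ℕ) (k : K) (i j : Fin 2) :
    ((m + 1 : ℕ) : ℂ) • (k.1 i j • T m k) =
      lower (m + 1) m i ∘ₗ T (m + 1) k ∘ₗ raise m (m + 1) j +
        rot (raise (m - 1) m) i ∘ₗ T (m - 1) k ∘ₗ rot (lower m (m - 1)) j := by
  ext1 p
  apply Subtype.ext
  -- With `T` moved innermost, both terms act on `T m k p`. The commutator of derivative and
  -- multiplication gives `k i j`, and the rest assembles to `k i j` times the Euler operator, in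
  -- total `m + 1`.
  have he := euler (T m k p)
  rw [← Nat.cast_smul_eq_nsmul ℂ, smul_eq_C_mul, map_natCast] at he
  rw [T_comp_raise]
  fin_cases i <;> fin_cases j <;>
  simp [rot, LinearMap.comp_neg, T_comp_lower_zero, T_comp_lower_one, lower_raise, raise_lower,
    LinearMap.comp_add, LinearMap.comp_smul, LinearMap.comp_sub, smul_eq_C_mul, mulVar_apply]
  · linear_combination (-C (k.1 0 0)) * he
  · linear_combination (-C (k.1 0 1)) * he
  · linear_combination (-C (k.1 1 0)) * he
  · linear_combination (-C (k.1 1 1)) * he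

/-! ### Clebsch-Gordan coefficients from transvectants of monomials -/

theorem invFactorial_natCast (m : ℕ) : invFactorial m = (m.factorial : ℝ)⁻¹ := by
  simp [invFactorial]

theorem invFactorial_of_neg {z : ℤ} (h : z < 0) : invFactorial z = 0 := if_neg (by omega)

/-- Valid for every integer, including `z = 0`, so that derivatives of divided monomials are pure
index shifts. -/
theorem invFactorial_sub_one (z : ℤ) : invFactorial (z - 1) = z * invFactorial z := by
  rcases lt_trichotomy z 0 with h | h | h
  · rw [invFactorial_of_neg h, invFactorial_of_neg (by omega), mul_zero]
  · rw [h, invFactorial_of_neg (by omega)]; simp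
  · obtain ⟨m, rfl⟩ : ∃ m : ℕ, z = (m + 1 : ℕ) := ⟨z.toNat - 1, by omega⟩
    rw [show ((m + 1 : ℕ) : ℤ) - 1 = (m : ℕ) by push_cast; ring, invFactorial_natCast,
      invFactorial_natCast, Nat.factorial_succ]
    have := m.factorial_ne_zero
    push_cast
    field_simp

theorem invFactorial_mul_eq_zero {y z : ℤ} (h : y + z < 0) :
    invFactorial y * invFactorial z = 0 := by
  rcases lt_or_ge y 0 with hy | hy
  · rw [invFactorial_of_neg hy, zero_mul]
  · rw [invFactorial_of_neg (z := z) (by omega), mul_zero]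

/-- The divided monomial `x^p y^q / (p! q!)`, which is zero for negative exponents. -/
def divMon (p q : ℤ) : Poly :=
  ((invFactorial p * invFactorial q : ℝ) : ℂ) • (X 0 ^ p.toNat * X 1 ^ q.toNat)

theorem der_zero_divMon (p q : ℤ) : der 0 (divMon p q) = divMon (p - 1) q := by
  rw [divMon, divMon, invFactorial_sub_one, map_smul, der_apply]
  rcases lt_or_ge p 0 with h | h
  · simp [invFactorial_of_neg h]
  · obtain ⟨m, rfl⟩ := Int.eq_ofNat_of_zero_le h
    have e : ((m : ℤ) - 1).toNat = m - 1 := by omega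
    simp [Derivation.leibniz, Derivation.leibniz_pow, pderiv_X, e, smul_eq_C_mul]
    ring

theorem der_one_divMon (p q : ℤ) : der 1 (divMon p q) = divMon p (q - 1) := by
  rw [divMon, divMon, invFactorial_sub_one, map_smul, der_apply]
  rcases lt_or_ge q 0 with h | h
  · simp [invFactorial_of_neg h]
  · obtain ⟨m, rfl⟩ := Int.eq_ofNat_of_zero_le h
    have e : ((m : ℤ) - 1).toNat = m - 1 := by omega
    simp [Derivation.leibniz, Derivation.leibniz_pow, pderiv_X, e, smul_eq_C_mul]
    ring

theorem map_der_zero_one_pow (k : ℕ) (p q p' q' : ℤ) :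
    (TensorProduct.map (der 0) (der 1) ^ k) (divMon p q ⊗ₜ divMon p' q') =
      divMon (p - k) q ⊗ₜ divMon p' (q' - k) := by
  induction k with
  | zero => simp
  | succ k ih =>
    rw [pow_succ', Module.End.mul_apply, ih, TensorProduct.map_tmul, der_zero_divMon,
      der_one_divMon]
    push_cast
    rw [sub_sub, sub_sub]

theorem map_der_one_zero_pow (k : ℕ) (p q p' q' : ℤ) :
    (TensorProduct.map (der 1) (der 0) ^ k) (divMon p q ⊗ₜ divMon p' q') =
      divMon p (q - k) ⊗ₜ divMon (p' - k) q' := by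
  induction k with
  | zero => simp
  | succ k ih =>
    rw [pow_succ', Module.End.mul_apply, ih, TensorProduct.map_tmul, der_zero_divMon,
      der_one_divMon]
    push_cast
    rw [sub_sub, sub_sub]

theorem omega_pow_divMon (r : ℕ) (p q p' q' : ℤ) :
    (omega ^ r) (divMon p q ⊗ₜ divMon p' q') =
      (-1 : ℂ) ^ r • ∑ k ∈ Finset.range (r + 1), ((-1 : ℂ) ^ k * r.choose k) •
        (divMon (p - k) (q - (r - k)) ⊗ₜ divMon (p' - (r - k)) (q' - k)) := by
  let α : Module.End ℂ (Poly ⊗[ℂ] Poly) := TensorProduct.map (der 0) (der 1)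
  let β : Module.End ℂ (Poly ⊗[ℂ] Poly) := TensorProduct.map (der 1) (der 0)
  -- The global sign is extracted so that the binomial theorem yields `(-1)^k`, with `k` as in the
  -- Clebsch-Gordan sum.
  have ho : omega = (-1 : ℂ) • ((-1 : ℂ) • α + β) := by
    rw [show (-1 : ℂ) • ((-1 : ℂ) • α + β) = α - β by module]
    rfl
  have hc : Commute α β := by
    apply TensorProduct.ext'
    intro f g
    simp [α, β, der_comm 1 0]
  rw [ho, smul_pow, (hc.smul_left (-1 : ℂ)).add_pow, LinearMap.smul_apply, LinearMap.sum_apply]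
  congr 1
  refine Finset.sum_congr rfl fun k hk => ?_
  have hk : k ≤ r := by simpa [Nat.lt_succ_iff] using hk
  rw [smul_pow, ← Nat.cast_comm, ← nsmul_eq_mul, LinearMap.smul_apply, smul_mul_assoc,
    LinearMap.smul_apply, Module.End.mul_apply, map_der_one_zero_pow, map_der_zero_one_pow,
    ← Nat.cast_smul_eq_nsmul ℂ, smul_smul, Nat.cast_sub hk, mul_comm]

theorem divMon_mul (p q p' q' : ℤ) : divMon p q * divMon p' q' =
    ((invFactorial p * invFactorial q' * invFactorial q * invFactorial p' : ℝ) : ℂ) •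
      (X 0 ^ (p + p').toNat * X 1 ^ (q + q').toNat) := by
  rw [divMon, divMon, smul_mul_smul_comm, ← Complex.ofReal_mul]
  by_cases h : 0 ≤ p ∧ 0 ≤ q ∧ 0 ≤ p' ∧ 0 ≤ q'
  · rw [Int.toNat_add h.1 h.2.2.1, Int.toNat_add h.2.1 h.2.2.2]
    congr 1
    · congr 1
      ring
    · ring
  · rw [show invFactorial p * invFactorial q * (invFactorial p' * invFactorial q') = 0 by
      simp [invFactorial]; omega,
      show invFactorial p * invFactorial q' * invFactorial q * invFactorial p' = 0 by
      simp [invFactorial]; omega]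
    simp

/-- The alternating sum in the formula for the Clebsch-Gordan coefficients. -/
def cgSum (r : ℕ) (p q p' q' : ℤ) : ℝ :=
  ∑ k ∈ Finset.range (r + 1), (-1 : ℝ) ^ k *
    (invFactorial k * invFactorial (r - k) * invFactorial (p - k) * invFactorial (q' - k) *
      invFactorial (q - r + k) * invFactorial (p' - r + k))

/-- In every summand two inverse factorials have arguments in which `k` cancels and whose sum is
negative. -/
theorem cgSum_eq_zero {r : ℕ} {p q p' q' : ℤ} (h : q + q' < r ∨ p + p' < r) :
    cgSum r p q p' q' = 0 := by
  refine Finset.sum_eq_zero fun k _ => ?_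
  rcases h with h | h
  · linear_combination (-1 : ℝ) ^ k * invFactorial k * invFactorial (r - k) *
      invFactorial (p - k) * invFactorial (p' - r + k) *
      invFactorial_mul_eq_zero (y := q' - k) (z := q - r + k) (by linarith)
  · linear_combination (-1 : ℝ) ^ k * invFactorial k * invFactorial (r - k) *
      invFactorial (q' - k) * invFactorial (q - r + k) *
      invFactorial_mul_eq_zero (y := p - k) (z := p' - r + k) (by linarith)

/-- The binomial coefficient supplies `1 / (k! (r-k)!)` and the divided monomials supply the other
four inverse factorials; on the diagonal all terms share one monomial. -/
theorem transvectant_divMon (r : ℕ) (p q p' q' : ℤ) :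
    transvectant r (divMon p q ⊗ₜ divMon p' q') =
      ((-1 : ℂ) ^ r * r.factorial * (cgSum r p q p' q' : ℝ)) •
        (X 0 ^ (p + p' - r).toNat * X 1 ^ (q + q' - r).toNat) := by
  rw [transvectant, LinearMap.comp_apply, omega_pow_divMon, map_smul, map_sum, mul_assoc,
    ← smul_smul, cgSum]
  push_cast
  rw [Finset.mul_sum, Finset.sum_smul]
  congr 1
  refine Finset.sum_congr rfl fun k hk => ?_
  have hk : k ≤ r := by simpa [Nat.lt_succ_iff] using hk
  rw [map_smul, LinearMap.mul'_apply, divMon_mul, smul_smul]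
  congr 1
  · have e : (r.choose k : ℂ) =
        r.factorial * ((invFactorial k * invFactorial (r - k) : ℝ) : ℂ) := by
      rw [← Nat.cast_sub hk, invFactorial_natCast, invFactorial_natCast, Nat.cast_choose ℂ hk]
      push_cast
      field_simp
    rw [e, show q - (r - k : ℤ) = q - r + k by ring, show p' - (r - k : ℤ) = p' - r + k by ring]
    push_cast
    ring
  · congr 3 <;> ring

theorem psi_eq_divMon (n : ℕ) (a : Fin (n + 1)) :
    (psi n a).1 = ((Real.sqrt n.factorial *
      Real.sqrt ((a : ℕ).factorial * (n - a : ℕ).factorial) : ℝ) : ℂ) •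
        divMon ((n : ℤ) - (a : ℕ)) (a : ℕ) := by
  have ha : (a : ℕ) ≤ n := by omega
  change C ((Real.sqrt (n.choose (n - a)) : ℝ) : ℂ) * (X 0 ^ (n - a : ℕ) * X 1 ^ (a : ℕ)) = _
  rw [divMon, smul_smul, ← smul_eq_C_mul, ← Complex.ofReal_mul, ← Nat.cast_sub ha,
    invFactorial_natCast, invFactorial_natCast, Int.toNat_natCast, Int.toNat_natCast]
  congr 2
  rw [Nat.cast_choose ℝ (Nat.sub_le n a), Nat.sub_sub_self ha, Real.sqrt_div (by positivity),
    mul_comm ((n - a : ℕ).factorial : ℝ)]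
  have h : (0 : ℝ) < (a : ℕ).factorial * (n - a : ℕ).factorial := by positivity
  have hs := Real.mul_self_sqrt h.le
  have hs' := Real.sqrt_pos.mpr h
  rw [div_eq_iff hs'.ne']
  field_simp
  rw [sq, hs]

/-- Isolates the factor `N`, which depends only on the degrees; of its value only `N ≠ 0` matters.
-/
theorem clebschGordan_eq {n₁ n₂ n r : ℕ} (hr : n₁ + n₂ = n + 2 * r) :
    ∃ N : ℝ, N ≠ 0 ∧ ∀ a₁ a₂ a,
    clebschGordan n₁ n₂ n a₁ a₂ a = if (a₁ : ℕ) + a₂ = a + r then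
      N * Real.sqrt ((a : ℕ).factorial * (n - a : ℕ).factorial) *
        Real.sqrt ((a₁ : ℕ).factorial * (n₁ - a₁ : ℕ).factorial) *
        Real.sqrt ((a₂ : ℕ).factorial * (n₂ - a₂ : ℕ).factorial) *
        cgSum r ((n₁ : ℤ) - (a₁ : ℕ)) (a₁ : ℕ) ((n₂ : ℤ) - (a₂ : ℕ)) (a₂ : ℕ) else 0 := by
  refine ⟨Real.sqrt (((n + 1) * (r.factorial * ((n₁ + n - n₂) / 2).factorial *
    ((n₂ + n - n₁) / 2).factorial) : ℝ) / ((n₁ + n₂ + n) / 2 + 1 : ℕ).factorial),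
    (Real.sqrt_pos.mpr (by positivity)).ne', fun a₁ a₂ a => ?_⟩
  have e : (n₁ + n₂ - n) / 2 = r := by omega
  simp only [clebschGordan, e]
  refine if_congr Iff.rfl ?_ rfl
  rw [Real.sqrt_mul (by positivity), Real.sqrt_mul (by positivity), cgSum]
  ring

theorem psiBasis_apply (n : ℕ) (a : Fin (n + 1)) : psiBasis n a = psi n a := by simp [psiBasis]

theorem inner_psi (n : ℕ) (a b : Fin (n + 1)) :
    inner ℂ (psi n a) (psi n b) = if a = b then (1 : ℂ) else 0 := by
  rw [← psiBasis_apply, ← psiBasis_apply]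
  exact orthonormal_iff_ite.mp (psiBasis_orthonormal n) a b

theorem beta_psi (n₁ n₂ n : ℕ) (a : Fin (n + 1)) : beta n₁ n₂ n (psi n a) = phiVec n₁ n₂ n a := by
  rw [beta, ← psiBasis_apply, Module.Basis.constr_basis]

theorem tensor_inner_smul_left {a b : ℕ} (c : ℂ) (x y : H a ⊗[ℂ] H b) :
    inner ℂ (c • x) y = starRingEnd ℂ c * inner ℂ x y :=
  inner_smul_left (𝕜 := ℂ) (E := H a ⊗[ℂ] H b) x y c

theorem tensor_inner_smul_right {a b : ℕ} (c : ℂ) (x y : H a ⊗[ℂ] H b) :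
    inner ℂ x (c • y) = c * inner ℂ x y :=
  inner_smul_right (𝕜 := ℂ) (E := H a ⊗[ℂ] H b) x y c

theorem tensor_inner_sub_left {a b : ℕ} (x y z : H a ⊗[ℂ] H b) :
    inner ℂ (x - y) z = (inner ℂ x z - inner ℂ y z : ℂ) :=
  inner_sub_left (𝕜 := ℂ) (E := H a ⊗[ℂ] H b) x y z

theorem tensor_inner_sub_right {a b : ℕ} (x y z : H a ⊗[ℂ] H b) :
    inner ℂ x (y - z) = (inner ℂ x y - inner ℂ x z : ℂ) :=
  inner_sub_right (𝕜 := ℂ) (E := H a ⊗[ℂ] H b) x y z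

theorem adjoint_beta_tmul (n₁ n₂ n : ℕ) (a₁ : Fin (n₁ + 1)) (a₂ : Fin (n₂ + 1)) :
    LinearMap.adjoint (beta n₁ n₂ n) (psi n₁ a₁ ⊗ₜ psi n₂ a₂) =
      ∑ a, (clebschGordan n₁ n₂ n a₁ a₂ a : ℂ) • psi n a := by
  refine InnerProductSpace.ext_inner_left_basis (psiBasis n) fun a => ?_
  rw [LinearMap.adjoint_inner_right, psiBasis_apply, beta_psi]
  simp only [phiVec, sum_inner, inner_sum, inner_smul_right, inner_psi, tensor_inner_smul_left,
    TensorProduct.inner_tmul]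
  simp

/-- Up to a nonzero constant, the adjoint of `beta` is a transvectant. -/
theorem adjoint_beta {n₁ n₂ n r : ℕ} (hr : n₁ + n₂ = n + 2 * r) : ∃ c : ℂ, c ≠ 0 ∧ ∀ z,
    (LinearMap.adjoint (beta n₁ n₂ n) z).1 = c • transvectant r (incl n₁ n₂ z) := by
  obtain ⟨N, hN, hC⟩ := clebschGordan_eq hr
  have hpos : ∀ m : ℕ, Real.sqrt m.factorial ≠ 0 := fun m =>
    (Real.sqrt_pos.mpr (by positivity)).ne'
  have hc : (-1 : ℝ) ^ r * r.factorial * Real.sqrt n₁.factorial * Real.sqrt n₂.factorial ≠ 0 :=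
    mul_ne_zero (mul_ne_zero (mul_ne_zero (by simp) (by positivity)) (hpos _)) (hpos _)
  -- The square roots in `a₁`, `a₂` agree on both sides, and the two in `a` cancel the denominators
  -- of the divided monomial; this ratio remains.
  refine ⟨((N * Real.sqrt n.factorial /
    ((-1) ^ r * r.factorial * Real.sqrt n₁.factorial * Real.sqrt n₂.factorial) : ℝ) : ℂ),
    Complex.ofReal_ne_zero.mpr (div_ne_zero (mul_ne_zero hN (hpos _)) hc), fun z => ?_⟩
  set c := N * Real.sqrt n.factorial /
    ((-1) ^ r * r.factorial * Real.sqrt n₁.factorial * Real.sqrt n₂.factorial) with hcdef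
  suffices h : (Submodule.subtype _ ∘ₗ LinearMap.adjoint (beta n₁ n₂ n) :
      H n₁ ⊗[ℂ] H n₂ →ₗ[ℂ] Poly) = (c : ℂ) • (transvectant r ∘ₗ incl n₁ n₂) from
    LinearMap.congr_fun h z
  refine ((psiBasis n₁).tensorProduct (psiBasis n₂)).ext fun ⟨a₁, a₂⟩ => ?_
  rw [Module.Basis.tensorProduct_apply, psiBasis_apply, psiBasis_apply, LinearMap.comp_apply,
    LinearMap.smul_apply, LinearMap.comp_apply, incl_tmul, adjoint_beta_tmul, map_sum]
  simp only [map_smul, Submodule.subtype_apply, psi_eq_divMon, ← TensorProduct.smul_tmul',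
    TensorProduct.tmul_smul, transvectant_divMon]
  have h₁ : (a₁ : ℕ) ≤ n₁ := by omega
  have h₂ : (a₂ : ℕ) ≤ n₂ := by omega
  by_cases h : r ≤ (a₁ : ℕ) + a₂ ∧ (a₁ : ℕ) + a₂ ≤ n + r
  · obtain ⟨a, ha⟩ : ∃ a : Fin (n + 1), (a₁ : ℕ) + a₂ = a + r :=
      ⟨⟨a₁ + a₂ - r, by omega⟩, by simp; omega⟩
    rw [Finset.sum_eq_single a]
    · rw [hC, if_pos ha, divMon, ← Nat.cast_sub (by omega : (a : ℕ) ≤ n), invFactorial_natCast,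
        invFactorial_natCast, smul_smul, smul_smul, smul_smul, smul_smul, smul_smul]
      congr 1
      · have := hpos n₁
        have := hpos n₂
        rw [hcdef]
        norm_cast
        field_simp
        rw [Real.sq_sqrt (by positivity)]
        push_cast
        ring
      · congr 3 <;> omega
    · intro b _ hb
      rw [hC, if_neg, Complex.ofReal_zero, zero_smul]
      intro hb'
      exact hb (Fin.ext (by omega))
    · simp
  -- The weight `a₁ + a₂ - r` lies outside `0, …, n`, so both sides vanish.
  · rw [cgSum_eq_zero (by omega), Finset.sum_eq_zero]
    · simp
    · intro b _
      rw [hC, if_neg (by omega), Complex.ofReal_zero, zero_smul]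

/-! ### The adjoint of `beta` against the four connecting operators -/

theorem incl_wedge {a b a' b' : ℕ} {f : Fin 2 → H a →ₗ[ℂ] H a'} {g : Fin 2 → H b →ₗ[ℂ] H b'}
    {F G : Fin 2 → Module.End ℂ Poly} (hf : ∀ i p, (f i p).1 = F i p.1)
    (hg : ∀ i p, (g i p).1 = G i p.1) (z : H a ⊗[ℂ] H b) :
    incl a' b' (wedge f g z) = wedge F G (incl a b z) := by
  induction z using TensorProduct.induction_on with
  | zero => simp
  | add z z' h h' => simp only [map_add, h, h']
  | tmul p q => simp only [wedge_tmul, incl_tmul, map_sub, hf, hg]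

theorem incl_dot {a b a' b' : ℕ} {f : Fin 2 → H a →ₗ[ℂ] H a'} {g : Fin 2 → H b →ₗ[ℂ] H b'}
    {F G : Fin 2 → Module.End ℂ Poly} (hf : ∀ i p, (f i p).1 = F i p.1)
    (hg : ∀ i p, (g i p).1 = G i p.1) (z : H a ⊗[ℂ] H b) :
    incl a' b' (dot f g z) = dot F G (incl a b z) := by
  induction z using TensorProduct.induction_on with
  | zero => simp
  | add z z' h h' => simp only [map_add, h, h']
  | tmul p q => simp only [dot_tmul, incl_tmul, map_add, hf, hg]

/-- Omega turns the transvectant of order `r` into that of order `r + 1`. The nonzero constant is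
what later makes the degree exact. -/
theorem adjoint_beta_wedge_lower {n₁ n₂ n r : ℕ} (hr : n₁ + n₂ = n + 2 * r) :
    ∃ c : ℂ, c ≠ 0 ∧ LinearMap.adjoint (beta n₁ n₂ n) ∘ₗ
        wedge (lower (n₁ + 1) n₁) (lower (n₂ + 1) n₂) =
      c • LinearMap.adjoint (beta (n₁ + 1) (n₂ + 1) n) := by
  obtain ⟨c, hc, h⟩ := adjoint_beta hr
  obtain ⟨c', hc', h'⟩ := adjoint_beta (show (n₁ + 1) + (n₂ + 1) = n + 2 * (r + 1) by omega)
  refine ⟨c / c', div_ne_zero hc hc', LinearMap.ext fun z => Subtype.ext ?_⟩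
  rw [LinearMap.comp_apply, h, LinearMap.smul_apply, Submodule.coe_smul, h', smul_smul,
    div_mul_cancel₀ c hc', incl_wedge (lower_coe rfl) (lower_coe rfl), transvectant, transvectant,
    pow_succ]
  rfl

/-- The condition on `c` excludes inadmissible types: if `n₂ ≤ r`, the second degree `n₂ - 1` is too
small for an order `r` transvectant, and the composite is zero. -/
theorem adjoint_beta_dot_lower_raise {n₁ n₂ n r : ℕ} (hr : n₁ + n₂ = n + 2 * r) :
    ∃ c : ℂ, (c ≠ 0 → r + 1 ≤ n₂) ∧ LinearMap.adjoint (beta n₁ n₂ n) ∘ₗ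
        dot (lower (n₁ + 1) n₁) (raise (n₂ - 1) n₂) =
      c • LinearMap.adjoint (beta (n₁ + 1) (n₂ - 1) n) := by
  obtain ⟨c, hc, h⟩ := adjoint_beta hr
  by_cases hn : r + 1 ≤ n₂
  · obtain ⟨m, rfl⟩ : ∃ m, n₂ = m + 1 := ⟨n₂ - 1, by omega⟩
    obtain ⟨c', hc', h'⟩ := adjoint_beta (show (n₁ + 1) + m = n + 2 * r by omega)
    refine ⟨c * ((n₁ + 1 - r : ℕ) : ℂ) / c', fun _ => hn, LinearMap.ext fun z => Subtype.ext ?_⟩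
    rw [LinearMap.smul_apply, Submodule.coe_smul]
    change (LinearMap.adjoint (beta n₁ (m + 1) n) (dot (lower (n₁ + 1) n₁) (raise m (m + 1)) z)).1 =
      _ • (LinearMap.adjoint (beta (n₁ + 1) m n) z).1
    rw [h, h', smul_smul, div_mul_cancel₀ _ hc', incl_dot (lower_coe rfl) (raise_coe rfl),
      transvectant_dot_der_mulVar, smul_smul]
  · refine ⟨0, fun h => absurd rfl h, LinearMap.ext fun z => Subtype.ext ?_⟩
    rw [LinearMap.comp_apply, h, zero_smul, LinearMap.zero_apply]
    cases n₂ with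
    | zero =>
      have e : (raise (0 - 1) 0 : Fin 2 → _) = 0 := funext fun i => raise_of_ne (by omega) i
      simp [e, dot]
    | succ m =>
      change c • transvectant r (incl _ _ (dot (lower (n₁ + 1) n₁) (raise m (m + 1)) z)) = 0
      rw [incl_dot (lower_coe rfl) (raise_coe rfl), transvectant_dot_der_mulVar,
        transvectant_eq_zero (by omega), smul_zero, smul_zero]

theorem adjoint_beta_dot_raise_lower {n₁ n₂ n r : ℕ} (hr : n₁ + n₂ = n + 2 * r) :
    ∃ c : ℂ, (c ≠ 0 → r + 1 ≤ n₁) ∧ LinearMap.adjoint (beta n₁ n₂ n) ∘ₗ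
        dot (raise (n₁ - 1) n₁) (lower (n₂ + 1) n₂) =
      c • LinearMap.adjoint (beta (n₁ - 1) (n₂ + 1) n) := by
  obtain ⟨c, hc, h⟩ := adjoint_beta hr
  by_cases hn : r + 1 ≤ n₁
  · obtain ⟨m, rfl⟩ : ∃ m, n₁ = m + 1 := ⟨n₁ - 1, by omega⟩
    obtain ⟨c', hc', h'⟩ := adjoint_beta (show m + (n₂ + 1) = n + 2 * r by omega)
    refine ⟨c * ((n₂ + 1 - r : ℕ) : ℂ) / c', fun _ => hn, LinearMap.ext fun z => Subtype.ext ?_⟩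
    rw [LinearMap.smul_apply, Submodule.coe_smul]
    change (LinearMap.adjoint (beta (m + 1) n₂ n) (dot (raise m (m + 1)) (lower (n₂ + 1) n₂) z)).1 =
      _ • (LinearMap.adjoint (beta m (n₂ + 1) n) z).1
    rw [h, h', smul_smul, div_mul_cancel₀ _ hc', incl_dot (raise_coe rfl) (lower_coe rfl),
      transvectant_dot_mulVar_der, smul_smul]
  · refine ⟨0, fun h => absurd rfl h, LinearMap.ext fun z => Subtype.ext ?_⟩
    rw [LinearMap.comp_apply, h, zero_smul, LinearMap.zero_apply]
    cases n₁ with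
    | zero =>
      have e : (raise (0 - 1) 0 : Fin 2 → _) = 0 := funext fun i => raise_of_ne (by omega) i
      simp [e, dot]
    | succ m =>
      change c • transvectant r (incl _ _ (dot (raise m (m + 1)) (lower (n₂ + 1) n₂) z)) = 0
      rw [incl_dot (raise_coe rfl) (lower_coe rfl), transvectant_dot_mulVar_der,
        transvectant_eq_zero (by omega), smul_zero, smul_zero]

/-- Multiplication by the determinant undoes one Omega up to a scalar; for `r = 0` it dies on the
diagonal. -/
theorem adjoint_beta_wedge_raise {n₁ n₂ n r : ℕ} (hr : n₁ + n₂ = n + 2 * r) (h₁ : r ≤ n₁)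
    (h₂ : r ≤ n₂) :
    ∃ c : ℂ, (c ≠ 0 → 1 ≤ r) ∧ LinearMap.adjoint (beta n₁ n₂ n) ∘ₗ
        wedge (raise (n₁ - 1) n₁) (raise (n₂ - 1) n₂) =
      c • LinearMap.adjoint (beta (n₁ - 1) (n₂ - 1) n) := by
  obtain ⟨c, hc, h⟩ := adjoint_beta hr
  have e : (raise (0 - 1) 0 : Fin 2 → _) = 0 := funext fun i => raise_of_ne (by omega) i
  rcases n₁ with _ | m₁
  · exact ⟨0, fun h => absurd rfl h, by
      rw [e, wedge_zero_left, LinearMap.comp_zero, zero_smul]⟩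
  rcases n₂ with _ | m₂
  · exact ⟨0, fun h => absurd rfl h, by
      rw [e, wedge_zero_right, LinearMap.comp_zero, zero_smul]⟩
  rcases r with _ | r
  · refine ⟨0, fun h => absurd rfl h, LinearMap.ext fun z => Subtype.ext ?_⟩
    rw [LinearMap.comp_apply, h, zero_smul, LinearMap.zero_apply]
    change c • transvectant 0 (incl _ _ (wedge (raise m₁ (m₁ + 1)) (raise m₂ (m₂ + 1)) z)) = 0
    rw [incl_wedge (raise_coe rfl) (raise_coe rfl), transvectant_zero_wedge, smul_zero]
  · obtain ⟨c', hc', h'⟩ := adjoint_beta (show m₁ + m₂ = n + 2 * r by omega)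
    obtain ⟨κ, hκ⟩ := transvectant_succ_wedge r m₁ m₂
    refine ⟨c * κ / c', fun _ => by omega, LinearMap.ext fun z => Subtype.ext ?_⟩
    rw [LinearMap.smul_apply, Submodule.coe_smul]
    change (LinearMap.adjoint (beta (m₁ + 1) (m₂ + 1) n)
      (wedge (raise m₁ (m₁ + 1)) (raise m₂ (m₂ + 1)) z)).1 =
      _ • (LinearMap.adjoint (beta m₁ m₂ n) z).1
    rw [h, h', smul_smul, div_mul_cancel₀ _ hc', incl_wedge (raise_coe rfl) (raise_coe rfl),
      hκ, smul_smul]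

/-! ### The product formula -/

theorem adjoint_wedge {a b a' b' : ℕ} (f : Fin 2 → H a →ₗ[ℂ] H a') (g : Fin 2 → H b →ₗ[ℂ] H b') :
    LinearMap.adjoint (wedge f g) =
      wedge (fun i => LinearMap.adjoint (f i)) (fun i => LinearMap.adjoint (g i)) := by
  rw [wedge, map_sub, TensorProduct.adjoint_map, TensorProduct.adjoint_map]
  rfl

theorem adjoint_dot {a b a' b' : ℕ} (f : Fin 2 → H a →ₗ[ℂ] H a') (g : Fin 2 → H b →ₗ[ℂ] H b') :
    LinearMap.adjoint (dot f g) =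
      dot (fun i => LinearMap.adjoint (f i)) (fun i => LinearMap.adjoint (g i)) := by
  rw [dot, map_add, TensorProduct.adjoint_map, TensorProduct.adjoint_map]
  rfl

theorem adjoint_raise_succ (m : ℕ) : (fun i => LinearMap.adjoint (raise m (m + 1) i)) =
    fun i => ((m + 1 : ℕ) : ℂ)⁻¹ • lower (m + 1) m i := by
  funext i
  rw [← adjoint_raise, inv_smul_smul₀]
  exact_mod_cast m.succ_ne_zero

theorem adjoint_lower_fun (m m' : ℕ) : (fun i => LinearMap.adjoint (lower m' m i)) =
    fun i => (m' : ℂ) • raise m m' i :=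
  funext (adjoint_lower m m')

theorem outerT_apply (n₁ n₂ : ℕ) (u : K × K) :
    outerT n₁ n₂ u = TensorProduct.map (T n₁ u.1) (T n₂ u.2) := rfl

/-- Only the left composite has to be computed: the right one, `A ∘ β`, is its adjoint up to `d`,
which also shows that the coefficient is nonzero when `c` and `d` are. -/
theorem comp_outerT_comp {n₁ n₂ m₁ m₂ n : ℕ} {B : H m₁ ⊗[ℂ] H m₂ →ₗ[ℂ] H n₁ ⊗[ℂ] H n₂}
    {A : H n₁ ⊗[ℂ] H n₂ →ₗ[ℂ] H m₁ ⊗[ℂ] H m₂} {c d : ℂ}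
    (hB : LinearMap.adjoint (beta n₁ n₂ n) ∘ₗ B = c • LinearMap.adjoint (beta m₁ m₂ n))
    (hA : LinearMap.adjoint A = d • B) (u : K × K) :
    LinearMap.adjoint (beta n₁ n₂ n) ∘ₗ (B ∘ₗ outerT m₁ m₂ u ∘ₗ A) ∘ₗ beta n₁ n₂ n =
      (c * starRingEnd ℂ (d * c)) • sphericalFunction m₁ m₂ n u := by
  have h : A ∘ₗ beta n₁ n₂ n = starRingEnd ℂ (d * c) • beta m₁ m₂ n := by
    rw [← LinearMap.adjoint_adjoint (A ∘ₗ beta n₁ n₂ n), LinearMap.adjoint_comp, hA,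
      LinearMap.comp_smul, hB, smul_smul, map_smulₛₗ, LinearMap.adjoint_adjoint]
  calc _ = (LinearMap.adjoint (beta n₁ n₂ n) ∘ₗ B) ∘ₗ outerT m₁ m₂ u ∘ₗ (A ∘ₗ beta n₁ n₂ n) := rfl
    _ = _ := by
      rw [hB, h, LinearMap.comp_smul, LinearMap.comp_smul, LinearMap.smul_comp, smul_smul,
        mul_comm c]
      rfl

/-- The product of an invariant bilinear form in the matrix entries of the two components with
`outerT n₁ n₂`, by the Clebsch-Gordan rule in both factors. -/
theorem smul_outerT (n₁ n₂ : ℕ) (u : K × K) :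
    (((n₁ + 1 : ℕ) : ℂ) * ((n₂ + 1 : ℕ) : ℂ) * (u.1.1 0 0 * u.2.1 1 1 - u.1.1 0 1 * u.2.1 1 0 -
        u.1.1 1 0 * u.2.1 0 1 + u.1.1 1 1 * u.2.1 0 0)) • outerT n₁ n₂ u =
      wedge (lower (n₁ + 1) n₁) (lower (n₂ + 1) n₂) ∘ₗ outerT (n₁ + 1) (n₂ + 1) u ∘ₗ
          wedge (raise n₁ (n₁ + 1)) (raise n₂ (n₂ + 1)) +
        dot (lower (n₁ + 1) n₁) (raise (n₂ - 1) n₂) ∘ₗ outerT (n₁ + 1) (n₂ - 1) u ∘ₗ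
          dot (raise n₁ (n₁ + 1)) (lower n₂ (n₂ - 1)) +
        dot (raise (n₁ - 1) n₁) (lower (n₂ + 1) n₂) ∘ₗ outerT (n₁ - 1) (n₂ + 1) u ∘ₗ
          dot (lower n₁ (n₁ - 1)) (raise n₂ (n₂ + 1)) +
        wedge (raise (n₁ - 1) n₁) (raise (n₂ - 1) n₂) ∘ₗ outerT (n₁ - 1) (n₂ - 1) u ∘ₗ
          wedge (lower n₁ (n₁ - 1)) (lower n₂ (n₂ - 1)) := by
  apply TensorProduct.ext'
  intro p q
  have h₁ := fun i j => LinearMap.congr_fun (entry_smul_T n₁ u.1 i j) p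
  have h₂ := fun i j => LinearMap.congr_fun (entry_smul_T n₂ u.2 i j) q
  simp only [LinearMap.smul_apply, LinearMap.add_apply, LinearMap.comp_apply] at h₁ h₂
  -- Each product of entries is split over the two tensor factors. Expanding gives sixteen terms,
  -- which the signs in `rot` group into the four composites of pairings.
  have e : (((n₁ + 1 : ℕ) : ℂ) * ((n₂ + 1 : ℕ) : ℂ) * (u.1.1 0 0 * u.2.1 1 1 -
      u.1.1 0 1 * u.2.1 1 0 - u.1.1 1 0 * u.2.1 0 1 + u.1.1 1 1 * u.2.1 0 0)) •
      (T n₁ u.1 p ⊗ₜ[ℂ] T n₂ u.2 q) =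
      (((n₁ + 1 : ℕ) : ℂ) • u.1.1 0 0 • T n₁ u.1 p) ⊗ₜ[ℂ]
          (((n₂ + 1 : ℕ) : ℂ) • u.2.1 1 1 • T n₂ u.2 q) -
        (((n₁ + 1 : ℕ) : ℂ) • u.1.1 0 1 • T n₁ u.1 p) ⊗ₜ[ℂ]
          (((n₂ + 1 : ℕ) : ℂ) • u.2.1 1 0 • T n₂ u.2 q) -
        (((n₁ + 1 : ℕ) : ℂ) • u.1.1 1 0 • T n₁ u.1 p) ⊗ₜ[ℂ]
          (((n₂ + 1 : ℕ) : ℂ) • u.2.1 0 1 • T n₂ u.2 q) +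
        (((n₁ + 1 : ℕ) : ℂ) • u.1.1 1 1 • T n₁ u.1 p) ⊗ₜ[ℂ]
          (((n₂ + 1 : ℕ) : ℂ) • u.2.1 0 0 • T n₂ u.2 q) := by
    simp only [smul_smul, TensorProduct.smul_tmul_smul]
    module
  rw [LinearMap.smul_apply, outerT_apply, TensorProduct.map_tmul, e]
  simp only [h₁, h₂, rot, LinearMap.add_apply, LinearMap.comp_apply, wedge_tmul, dot_tmul,
    outerT_apply, map_add, map_sub, TensorProduct.map_tmul]
  simp [TensorProduct.add_tmul, TensorProduct.tmul_add, TensorProduct.neg_tmul,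
    TensorProduct.tmul_neg]
  abel

theorem product_formula {n₁ n₂ n r : ℕ} (hr : n₁ + n₂ = n + 2 * r) (hr₁ : r ≤ n₁) (hr₂ : r ≤ n₂) :
    ∃ c c₁ c₂ c₃ : ℂ, c ≠ 0 ∧ (c₁ ≠ 0 → r + 1 ≤ n₂) ∧ (c₂ ≠ 0 → r + 1 ≤ n₁) ∧ (c₃ ≠ 0 → 1 ≤ r) ∧
      ∀ u : K × K, (u.1.1 0 0 * u.2.1 1 1 - u.1.1 0 1 * u.2.1 1 0 -
        u.1.1 1 0 * u.2.1 0 1 + u.1.1 1 1 * u.2.1 0 0) • sphericalFunction n₁ n₂ n u =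
          c • sphericalFunction (n₁ + 1) (n₂ + 1) n u +
          c₁ • sphericalFunction (n₁ + 1) (n₂ - 1) n u +
          c₂ • sphericalFunction (n₁ - 1) (n₂ + 1) n u +
          c₃ • sphericalFunction (n₁ - 1) (n₂ - 1) n u := by
  obtain ⟨c, hc, h⟩ := adjoint_beta_wedge_lower hr
  obtain ⟨c₁, hc₁, h₁⟩ := adjoint_beta_dot_lower_raise hr
  obtain ⟨c₂, hc₂, h₂⟩ := adjoint_beta_dot_raise_lower hr
  obtain ⟨c₃, hc₃, h₃⟩ := adjoint_beta_wedge_raise hr hr₁ hr₂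
  have hN₁ : ((n₁ + 1 : ℕ) : ℂ) ≠ 0 := by exact_mod_cast n₁.succ_ne_zero
  have hN₂ : ((n₂ + 1 : ℕ) : ℂ) ≠ 0 := by exact_mod_cast n₂.succ_ne_zero
  have hN := mul_ne_zero hN₁ hN₂
  have e := comp_outerT_comp h (A := wedge (raise n₁ (n₁ + 1)) (raise n₂ (n₂ + 1))) (by
    rw [adjoint_wedge, adjoint_raise_succ, adjoint_raise_succ, wedge_smul_smul])
  have e₁ := comp_outerT_comp h₁ (A := dot (raise n₁ (n₁ + 1)) (lower n₂ (n₂ - 1))) (by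
    rw [adjoint_dot, adjoint_raise_succ, adjoint_lower_fun, dot_smul_smul])
  have e₂ := comp_outerT_comp h₂ (A := dot (lower n₁ (n₁ - 1)) (raise n₂ (n₂ + 1))) (by
    rw [adjoint_dot, adjoint_raise_succ, adjoint_lower_fun, dot_smul_smul])
  have e₃ := comp_outerT_comp h₃ (A := wedge (lower n₁ (n₁ - 1)) (lower n₂ (n₂ - 1))) (by
    rw [adjoint_wedge, adjoint_lower_fun, adjoint_lower_fun, wedge_smul_smul])
  set N := ((n₁ + 1 : ℕ) : ℂ) * ((n₂ + 1 : ℕ) : ℂ) with hNdef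
  -- The inner scalars come from the adjoints: `(m + 1)⁻¹` for each `raise`, the upper degree for
  -- each `lower`.
  refine ⟨N⁻¹ * (c * starRingEnd ℂ (((n₁ + 1 : ℕ) : ℂ)⁻¹ * ((n₂ + 1 : ℕ) : ℂ)⁻¹ * c)),
    N⁻¹ * (c₁ * starRingEnd ℂ (((n₁ + 1 : ℕ) : ℂ)⁻¹ * (n₂ : ℂ) * c₁)),
    N⁻¹ * (c₂ * starRingEnd ℂ ((n₁ : ℂ) * ((n₂ + 1 : ℕ) : ℂ)⁻¹ * c₂)),
    N⁻¹ * (c₃ * starRingEnd ℂ ((n₁ : ℂ) * (n₂ : ℂ) * c₃)), ?_,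
    fun h => hc₁ (left_ne_zero_of_mul (right_ne_zero_of_mul h)),
    fun h => hc₂ (left_ne_zero_of_mul (right_ne_zero_of_mul h)),
    fun h => hc₃ (left_ne_zero_of_mul (right_ne_zero_of_mul h)), fun u => ?_⟩
  rotate_left
  · simp only [mul_smul N⁻¹]
    rw [← e u, ← e₁ u, ← e₂ u, ← e₃ u, ← smul_add, ← smul_add, ← smul_add, eq_inv_smul_iff₀ hN,
      smul_smul, ← LinearMap.comp_add, ← LinearMap.comp_add, ← LinearMap.comp_add,
      ← LinearMap.add_comp, ← LinearMap.add_comp, ← LinearMap.add_comp, ← smul_outerT,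
      LinearMap.smul_comp, LinearMap.comp_smul]
    rfl
  · refine mul_ne_zero (inv_ne_zero hN) (mul_ne_zero hc ?_)
    rw [Ne, map_eq_zero]
    exact mul_ne_zero (mul_ne_zero (inv_ne_zero hN₁) (inv_ne_zero hN₂)) hc

/-! ### The zonal function -/

theorem T_one_psi (k : K) (a : Fin 2) :
    T 1 k (psi 1 a) = k.1 0 a • psi 1 0 + k.1 1 a • psi 1 1 := by
  apply Subtype.ext
  have h0 : (psi 1 0).1 = X 0 := by simp [psi]
  have h1 : (psi 1 1).1 = X 1 := by simp [psi]
  rw [Submodule.coe_add, Submodule.coe_smul, Submodule.coe_smul, h0, h1, T_coe, smul_eq_C_mul,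
    smul_eq_C_mul]
  fin_cases a
  · simp only [Fin.zero_eta, h0, bind₁_X_right, toMvPolynomial_transpose]
  · simp only [Fin.mk_one, h1, bind₁_X_right, toMvPolynomial_transpose]

theorem phiVec_one_one_zero : phiVec 1 1 0 0 =
    ((Real.sqrt (1 / 2) : ℝ) : ℂ) • (psi 1 1 ⊗ₜ psi 1 0 - psi 1 0 ⊗ₜ psi 1 1) := by
  have h00 : clebschGordan 1 1 0 0 0 0 = 0 := by simp [clebschGordan]
  have h11 : clebschGordan 1 1 0 1 1 0 = 0 := by simp [clebschGordan]
  have h01 : clebschGordan 1 1 0 0 1 0 = -Real.sqrt (1 / 2) := by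
    norm_num [clebschGordan, Finset.sum_range_succ, invFactorial]
  have h10 : clebschGordan 1 1 0 1 0 0 = Real.sqrt (1 / 2) := by
    norm_num [clebschGordan, Finset.sum_range_succ, invFactorial]
  simp only [phiVec, Nat.reduceAdd, Fin.sum_univ_two, h00, h11, h01, h10]
  push_cast
  module

/-- `φ` is the diagonal matrix coefficient of the singlet `(ψ₁ ⊗ ψ₀ - ψ₀ ⊗ ψ₁) / √2`; its squared
normalisation accounts for the factor 2. -/
theorem zonal_eq (u : K × K) : u.1.1 0 0 * u.2.1 1 1 - u.1.1 0 1 * u.2.1 1 0 -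
    u.1.1 1 0 * u.2.1 0 1 + u.1.1 1 1 * u.2.1 0 0 = 2 * zonal u := by
  rw [zonal, LinearMap.trace_eq_sum_inner _
    ((psiBasis 0).toOrthonormalBasis (psiBasis_orthonormal 0)), Fin.sum_univ_one]
  rw [Module.Basis.coe_toOrthonormalBasis, psiBasis_apply, sphericalFunction, LinearMap.comp_apply,
    LinearMap.adjoint_inner_right, LinearMap.comp_apply, beta_psi, phiVec_one_one_zero, map_smul,
    tensor_inner_smul_left, tensor_inner_smul_right, map_sub, outerT_apply, TensorProduct.map_tmul,
    TensorProduct.map_tmul, T_one_psi, T_one_psi, T_one_psi, T_one_psi]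
  simp only [tensor_inner_sub_left, tensor_inner_sub_right, TensorProduct.inner_tmul,
    inner_add_right, inner_smul_right, inner_psi]
  have h : ((Real.sqrt (1 / 2) : ℝ) : ℂ) * ((Real.sqrt (1 / 2) : ℝ) : ℂ) = 1 / 2 := by
    rw [← Complex.ofReal_mul, Real.mul_self_sqrt (by norm_num)]
    norm_num
  rw [Complex.conj_ofReal, ← mul_assoc (Complex.ofReal _), h]
  simp
  ring

/-! ### Induction on `r` -/

/-- The `U`-functions which are combinations of the spherical functions of lowest degree, with
polynomials in the zonal spherical function of degree at most `d` as coefficients. -/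
def combinations (n d : ℕ) : Submodule ℂ (K × K → Module.End ℂ (H n)) where
  carrier := {F | ∃ q : Fin (n + 1) → Polynomial ℂ, (∀ i, (q i).degree ≤ d) ∧ ∀ u, F u =
    ∑ i : Fin (n + 1), (q i).eval (zonal u) • sphericalFunction (i : ℕ) (n - i : ℕ) n u}
  zero_mem' := ⟨0, by simp, by simp⟩
  add_mem' := by
    rintro F G ⟨p, hp, hF⟩ ⟨q, hq, hG⟩
    refine ⟨p + q, fun i => (Polynomial.degree_add_le _ _).trans (max_le (hp i) (hq i)),
      fun u => ?_⟩
    simp [hF, hG, add_smul, Finset.sum_add_distrib]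
  smul_mem' := by
    rintro c F ⟨p, hp, hF⟩
    refine ⟨c • p, fun i => (Polynomial.degree_smul_le _ _).trans (hp i), fun u => ?_⟩
    simp [hF, Finset.smul_sum, smul_smul]

theorem combinations_mono {n d e : ℕ} (h : d ≤ e) : combinations n d ≤ combinations n e := by
  rintro F ⟨q, hq, hF⟩
  exact ⟨q, fun i => (hq i).trans (by exact_mod_cast h), hF⟩

theorem degree_eq_iff_coeff_ne_zero {p : Polynomial ℂ} {m : ℕ} (h : p.degree ≤ m) :
    p.degree = m ↔ p.coeff m ≠ 0 :=
  ⟨Polynomial.coeff_ne_zero_of_eq_degree, fun h' =>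
    le_antisymm h (Polynomial.le_degree_of_ne_zero h')⟩

/-- The coefficient at `r + 1` is `2 c⁻¹` times that of `p` at `r`, since `g` does not reach this
degree. -/
theorem degree_recurrence {p g : Polynomial ℂ} {c : ℂ} {r : ℕ} (hc : c ≠ 0) (hp : p.degree ≤ r)
    (hg : g.degree ≤ r) :
    (c⁻¹ • ((2 : ℂ) • (Polynomial.X * p) - g)).degree ≤ ((r + 1 : ℕ) : WithBot ℕ) ∧
      ((c⁻¹ • ((2 : ℂ) • (Polynomial.X * p) - g)).degree = ((r + 1 : ℕ) : WithBot ℕ) ↔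
        p.degree = r) := by
  have h : (c⁻¹ • ((2 : ℂ) • (Polynomial.X * p) - g)).degree ≤ ((r + 1 : ℕ) : WithBot ℕ) := by
    refine (Polynomial.degree_smul_le _ _).trans ((Polynomial.degree_sub_le _ _).trans
      (max_le ((Polynomial.degree_smul_le _ _).trans ?_) (hg.trans ?_)))
    · rw [mul_comm, Polynomial.degree_mul_X]
      exact_mod_cast add_le_add_left hp 1
    · exact_mod_cast r.le_succ
  have hg' : g.coeff (r + 1) = 0 :=
    Polynomial.coeff_eq_zero_of_degree_lt (hg.trans_lt (by exact_mod_cast r.lt_succ_self))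
  refine ⟨h, ?_⟩
  rw [degree_eq_iff_coeff_ne_zero h, degree_eq_iff_coeff_ne_zero hp]
  simp [Polynomial.coeff_X_mul, hg', hc]

/-- With `s = n₁ - r` and `t = n₂ - r`, the neighbours in the product formula are `(s, t)` at `r ±
1` and `(s ± 1, t ∓ 1)` at `r`. Hence the induction is strong and runs over all `s + t = n` at once.
-/
theorem exists_sphericalFunction_eq (n r : ℕ) : ∀ s t : ℕ, s + t = n →
    ∃ q : Fin (n + 1) → Polynomial ℂ,
      (∀ u, sphericalFunction (s + r) (t + r) n u =
        ∑ i : Fin (n + 1), (q i).eval (zonal u) • sphericalFunction (i : ℕ) (n - i : ℕ) n u) ∧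
      (∀ i, (q i).degree ≤ r) ∧ ∀ i, (q i).degree = r ↔ s = i := by
  induction r using Nat.strong_induction_on with
  | _ r ih =>
  rcases r with _ | r
  · intro s t hst
    refine ⟨fun i => if s = i then 1 else 0, fun u => ?_, fun i => ?_, fun i => ?_⟩
    · rw [Finset.sum_eq_single (⟨s, by omega⟩ : Fin (n + 1))]
      · simp [show n - s = t by omega]
      · intro b _ hb
        beta_reduce
        rw [if_neg (fun h => hb (Fin.ext h.symm))]
        simp
      · simp
    · beta_reduce
      split_ifs <;> simp
    · beta_reduce
      split_ifs with h <;> simp [h]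
  · have mem : ∀ e ≤ r, ∀ s t, s + t = n →
        (fun u => sphericalFunction (s + e) (t + e) n u) ∈ combinations n r := by
      intro e he s t hst
      obtain ⟨q, hq, hd, -⟩ := ih e (by omega) s t hst
      exact combinations_mono he ⟨q, hd, hq⟩
    intro s t hst
    obtain ⟨p, hp, hpd, hpe⟩ := ih r (by omega) s t hst
    obtain ⟨c, c₁, c₂, c₃, hc, hc₁, hc₂, hc₃, h⟩ := product_formula
      (show (s + r) + (t + r) = n + 2 * r by omega) (by omega) (by omega)
    -- Either the coefficient is zero, or its side condition gives `t ≥ 1`, so that `t - 1` is a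
    -- true subtraction.
    have m₁ : c₁ • (fun u => sphericalFunction (s + r + 1) (t + r - 1) n u) ∈
        combinations n r := by
      by_cases hz : c₁ = 0
      · rw [hz, zero_smul]
        exact zero_mem _
      · have := hc₁ hz
        have hm := Submodule.smul_mem _ c₁ (mem r le_rfl (s + 1) (t - 1) (by omega))
        rwa [show s + 1 + r = s + r + 1 by omega, show t - 1 + r = t + r - 1 by omega] at hm
    have m₂ : c₂ • (fun u => sphericalFunction (s + r - 1) (t + r + 1) n u) ∈
        combinations n r := by
      by_cases hz : c₂ = 0
      · rw [hz, zero_smul]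
        exact zero_mem _
      · have := hc₂ hz
        have hm := Submodule.smul_mem _ c₂ (mem r le_rfl (s - 1) (t + 1) (by omega))
        rwa [show s - 1 + r = s + r - 1 by omega, show t + 1 + r = t + r + 1 by omega] at hm
    have m₃ : c₃ • (fun u => sphericalFunction (s + r - 1) (t + r - 1) n u) ∈
        combinations n r := by
      by_cases hz : c₃ = 0
      · rw [hz, zero_smul]
        exact zero_mem _
      · have := hc₃ hz
        have hm := Submodule.smul_mem _ c₃ (mem (r - 1) (by omega) s t hst)
        rwa [show s + (r - 1) = s + r - 1 by omega, show t + (r - 1) = t + r - 1 by omega] at hm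
    obtain ⟨g, hgd, hg⟩ := add_mem (add_mem m₁ m₂) m₃
    refine ⟨fun i => c⁻¹ • ((2 : ℂ) • (Polynomial.X * p i) - g i), fun u => ?_,
      fun i => (degree_recurrence hc (hpd i) (hgd i)).1,
      fun i => (degree_recurrence hc (hpd i) (hgd i)).2.trans (hpe i)⟩
    have hu := h u
    have hgu := hg u
    simp only [Pi.add_apply, Pi.smul_apply] at hgu
    rw [add_assoc, add_assoc, ← add_assoc (c₁ • _), hgu, zonal_eq, hp u, ← sub_eq_iff_eq_add,
      eq_comm, ← eq_inv_smul_iff₀ hc] at hu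
    change sphericalFunction (s + r + 1) (t + r + 1) n u = _
    rw [hu, Finset.smul_sum, ← Finset.sum_sub_distrib, Finset.smul_sum]
    refine Finset.sum_congr rfl fun i _ => ?_
    simp only [Polynomial.eval_smul, Polynomial.eval_sub, Polynomial.eval_mul, Polynomial.eval_X,
      smul_eq_mul]
    module

end SU2Spherical

end

theorem mainTheorem8 (n₁ n₂ n d : ℕ) (hd : n₁ + n₂ = n + 2 * d)
    (h₁ : n₁ ≤ n₂ + n) (h₂ : n₂ ≤ n₁ + n) :
    ∃ q : Fin (n + 1) → Polynomial ℂ,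
      (∀ u : SU2Spherical.K × SU2Spherical.K,
        SU2Spherical.sphericalFunction n₁ n₂ n u =
          ∑ i : Fin (n + 1), (q i).eval (SU2Spherical.zonal u) •
            SU2Spherical.sphericalFunction (i : ℕ) (n - i : ℕ) n u) ∧
      (∀ i : Fin (n + 1), (q i).degree ≤ d) ∧
      (∀ i : Fin (n + 1), (q i).degree = d ↔ n₁ + n = n₂ + 2 * i) := by
  -- The triangle inequalities say exactly that `d ≤ n₁` and `d ≤ n₂`.
  obtain ⟨s, rfl⟩ : ∃ s, n₁ = s + d := ⟨n₁ - d, by omega⟩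
  obtain ⟨t, rfl⟩ : ∃ t, n₂ = t + d := ⟨n₂ - d, by omega⟩
  obtain ⟨q, hq, hle, heq⟩ := SU2Spherical.exists_sphericalFunction_eq n d s t (by omega)
  -- Here `n₁ + n - n₂ = 2s`, so `i = s` is the index `ℓ + j` with `j = ℓ₁ - ℓ₂`.
  exact ⟨q, hq, hle, fun i => (heq i).trans (by omega)⟩
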